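/- **Setting.** Let $n\ge 2$, write points of $\mathbb R^n$ as $z=(x,y)$ with $x\in\mathbb R^{n-1}$, $y\in\mathbb R$. Let $(\Omega,\mathcal F,P)$ be a probability space and let $w:\mathbb R\times\Omega\to\mathbb R$ be *mild white noise*: (i) there is $M>0$ with $w(\cdot,\omega)\in C^1(\mathbb R)$ and $|w|,|w'|\le M$ almost surely; (ii) $E[w(y)]=0$ for all $y$; (iii) $w$ is stationary and, for some $p>3/2$, $\int_0^\infty\varrho(y)^{1/p}\,dy<\infty$, where $$\varrho(y)=\sup_{y_1\le y_2}\ \sup\Big\{\tfrac{|P(A\cap B)-P(A)P(B)|}{P(B)}: A\in\sigma(w(s):s\ge y_2+y),\ B\in\sigma(w(s):y_1\le s\le y_2)\Big\}$$ (null events $B$ contributing $0$); and, as a normalization, $2\int_0^\infty E[w(0)w(\xi)]\,d\xi=1$. Let $u(x,y,t)=(u_\perp(x,y,t),\,u_\parallel(x,t)\,w(y))$ with $u_\perp\in C^2(\mathbb R^n\times[0,\infty))^{n-1}$ and $u_\parallel\in C^2(\mathbb R^{n-1}\times[0,\infty))$. Let $\alpha\in[1,\infty]$ (with $\epsilon^\infty=0$),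 and let $\epsilon>0$ satisfy $\epsilon|u|\le 1/100$ on $\mathbb R^n\times[0,\infty)$. The *G-equation* with datum $G_0$ is $$G_t+\epsilon\,u(x,y,\epsilon^\alpha t)\cdot\nabla G+|\nabla G|=0\ \text{ in }\mathbb R^n\times(0,\infty),\qquad G=G_0\ \text{ on }\mathbb R^n\times\{0\}.\tag{1}$$ A solution is a locally bounded, possibly discontinuous, viscosity solution on $\mathbb R^n\times[0,\infty)$: the upper (lower) semicontinuous envelope of $G$ is a viscosity subsolution (supersolution) for $t>0$, $G(\cdot,0)=G_0$, and $G^*(\cdot,0)\le (G_0)^*$, $G_*(\cdot,0)\ge (G_0)_*$. A function $G_0\in L^\infty_{\rm loc}(\mathbb R^n)$ is *front-like* if there are locally Lipschitz $\underline G,\overline G:\mathbb R\to\mathbb R$ that are $C^1$ with positive derivative on $\mathbb R\setminus\{0\}$, vanish at $0$, and satisfy $\underline G(y)\le G_0(x,y)\le\overline G(y)$ for all $(x,y)$. A *perturbed traveling wave* is a function $G^\epsilon_{\rm ptw}(x,y,t)=y-t+\epsilon^{2/3}\chi^\epsilon(x,\epsilon^{2/3}y,\epsilon^{2/3}t)$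 that solves the G-equation, i.e. (1) with datum $G^\epsilon_{\rm ptw}(\cdot,\cdot,0)$, and whose initial datum $G^\epsilon_{\rm ptw}(\cdot,\cdot,0)$ is front-like. **Proposition.** For almost every $\omega\in\Omega$, and for all $\epsilon$, $\alpha$ as above, the following hold. (a) Let $\rho^\epsilon$ be a globally Lipschitz solution of the planar metric problem $\epsilon u(\cdot,0)\cdot\nabla\rho^\epsilon+|\nabla\rho^\epsilon|=1$ with $\rho^\epsilon=0$ on $\{y=0\}$ and, uniformly in $x$, $\liminf_{y\to\infty}\rho^\epsilon\ge0$ and $\limsup_{y\to-\infty}\rho^\epsilon\le0$. The equation is understood in the viscosity sense for $\rho^\epsilon$ in $\{y>0\}$ and, symmetrically, in the viscosity sense for $-\rho^\epsilon$, i.e. as $-\epsilon u(\cdot,0)\cdot\nabla(-\rho^\epsilon)+|\nabla(-\rho^\epsilon)|=1$, in $\{y<0\}$. Then every function of the form $y-t+\epsilon^{2/3}\chi^\epsilon(x,\epsilon^{2/3}y,\epsilon^{2/3}t)$ that solves (1) with datum $\rho^\epsilon$ is a perturbed traveling wave. (b) Let $G^\epsilon_{\rm ptw}$ be a perturbed traveling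 wave, and let $G^\epsilon$ solve (1) with a front-like datum $G_0$. Then, for every $t>0$, $$\{(x,y): G^\epsilon(x,y,t)=0\}=\{(x,y):G^\epsilon_{\rm ptw}(x,y,t)=0\}.$$ Moreover, $\{G^\epsilon\le0\}=\{G^\epsilon_{\rm ptw}\le 0\}$ as subsets of $\mathbb R^n\times[0,\infty)$. -/

import Mathlib

open MeasureTheory Filter Topology Set
open scoped ENNReal RealInnerProductSpace

noncomputable section

namespace GEq

/-- `ℝ^d` with the Euclidean norm (the transverse variable `x`). -/
abbrev Tr (d : ℕ) : Type := EuclideanSpace ℝ (Fin d)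

/-- `ℝ^{d+1} = ℝ^d × ℝ` with the Euclidean norm; points are `(x, y)`, `x = z.fst`, `y = z.snd`. -/
abbrev Pt (d : ℕ) : Type := WithLp 2 (Tr d × ℝ)

/-! ### Mild white noise -/

section Noise

variable {Ω : Type*} [MeasurableSpace Ω]

/-- The σ-algebra generated by `w y`, `y ∈ I`. -/
@[reducible] def sigmaOn (w : ℝ → Ω → ℝ) (I : Set ℝ) : MeasurableSpace Ω :=
  ⨆ y ∈ I, MeasurableSpace.comap (w y) inferInstance

/-- The strong mixing rate of `w` (with the convention that null events `B` contribute `0`). -/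
def mixingRate (P : Measure Ω) (w : ℝ → Ω → ℝ) (y : ℝ) : ℝ≥0∞ :=
  ⨆ (y₁ : ℝ) (y₂ : ℝ) (_ : y₁ ≤ y₂) (A : Set Ω) (_ : MeasurableSet[sigmaOn w (Ici (y₂ + y))] A)
    (B : Set Ω) (_ : MeasurableSet[sigmaOn w (Icc y₁ y₂)] B),
    ENNReal.ofReal |P.real (A ∩ B) - P.real A * P.real B| / P B

/-- Mild approximation of white noise, normalized so that the limiting Brownian motion is
standard. -/
structure IsMildWhiteNoise (P : Measure Ω) (w : ℝ → Ω → ℝ) : Prop where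
  measurable : ∀ y, Measurable (w y)
  c1_bound : ∃ M : ℝ, 0 < M ∧ ∀ᵐ ω ∂P, ContDiff ℝ 1 (fun y => w y ω) ∧
    ∀ y, |w y ω| ≤ M ∧ |deriv (fun y' => w y' ω) y| ≤ M
  mean_zero : ∀ y, ∫ ω, w y ω ∂P = 0
  stationary : ∀ h : ℝ, P.map (fun ω y => w (y + h) ω) = P.map (fun ω y => w y ω)
  mixing : ∃ p : ℝ, 3 / 2 < p ∧ ∫⁻ y in Ioi (0 : ℝ), mixingRate P w y ^ (1 / p) < ∞
  normalized : 2 * ∫ ξ in Ioi (0 : ℝ), (∫ ω, w 0 ω * w ξ ω ∂P) = 1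

end Noise

/-! ### The advection -/

/-- `u(x, y, t) = (u_⊥(x, y, t), u_∥(x, t) v(y))`, where `v` is one realization of the noise. -/
def advection {d : ℕ} (uperp : Tr d × ℝ × ℝ → Tr d) (upar : Tr d × ℝ → ℝ) (v : ℝ → ℝ)
    (z : Pt d) (t : ℝ) : Pt d :=
  WithLp.toLp 2 (uperp (z.fst, z.snd, t), upar (z.fst, t) * v z.snd)

/-- `ε ^ α` for `α ∈ [0, ∞]`, with the convention `ε ^ ∞ = 0`. -/
def epsPow (ε : ℝ) (α : ℝ≥0∞) : ℝ := if α = ∞ then 0 else ε ^ α.toReal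

/-! ### Front-like initial data -/

/-- Admissible one-dimensional barriers: locally Lipschitz on `ℝ`, `C¹` with positive derivative
away from `0`, and vanishing at `0`. -/
structure IsBarrier (g : ℝ → ℝ) : Prop where
  locallyLipschitz : LocallyLipschitz g
  contDiffOn : ContDiffOn ℝ 1 g {0}ᶜ
  deriv_pos : ∀ y, y ≠ 0 → 0 < deriv g y
  zero : g 0 = 0

structure IsFrontLike {d : ℕ} (G₀ : Pt d → ℝ) : Prop where
  locallyBounded : ∀ K : Set (Pt d), IsCompact K → MemLp G₀ ∞ (volume.restrict K)
  barriers : ∃ glow gup : ℝ → ℝ, IsBarrier glow ∧ IsBarrier gup ∧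
    ∀ z : Pt d, glow z.snd ≤ G₀ z ∧ G₀ z ≤ gup z.snd

/-! ### Viscosity solutions -/

/-- Upper semicontinuous envelope of `f`, as a function on the set `S`. -/
def upperEnv {X : Type*} [TopologicalSpace X] (S : Set X) (f : X → ℝ) (p : X) : ℝ :=
  limsup f (𝓝[S] p)

/-- Lower semicontinuous envelope of `f`, as a function on the set `S`. -/
def lowerEnv {X : Type*} [TopologicalSpace X] (S : Set X) (f : X → ℝ) (p : X) : ℝ :=
  liminf f (𝓝[S] p)

/-- The closed space-time half space `ℝ^{d+1} × [0, ∞)`. -/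
def spaceTime (d : ℕ) : Set (Pt d × ℝ) := {p | 0 ≤ p.2}

/-- The expression `φ_t + ε u(x, y, ε^α t) · ∇φ + |∇φ|` at the space-time point `p`. -/
def gOperator {d : ℕ} (ε : ℝ) (α : ℝ≥0∞) (u : Pt d → ℝ → Pt d) (φ : Pt d × ℝ → ℝ)
    (p : Pt d × ℝ) : ℝ :=
  deriv (fun s => φ (p.1, s)) p.2
    + ε * ⟪u p.1 (epsPow ε α * p.2), gradient (fun z => φ (z, p.2)) p.1⟫
    + ‖gradient (fun z => φ (z, p.2)) p.1‖

/-- `G` is a (possibly discontinuous) viscosity solution of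
`G_t + ε u(x, y, ε^α t) · ∇G + |∇G| = 0` in `ℝ^{d+1} × (0, ∞)` with `G = G₀` at `t = 0`:
`G` is locally bounded, its upper envelope is a subsolution, its lower envelope is a supersolution,
and the envelopes are controlled at `t = 0` by those of `G₀`.  Only the values of `G` for `t ≥ 0`
matter. -/
structure SolvesGEquation {d : ℕ} (ε : ℝ) (α : ℝ≥0∞) (u : Pt d → ℝ → Pt d)
    (G₀ : Pt d → ℝ) (G : Pt d × ℝ → ℝ) : Prop where
  locallyBounded : ∀ K ⊆ spaceTime d, IsCompact K → ∃ C : ℝ, ∀ p ∈ K, |G p| ≤ C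
  initial : ∀ z, G (z, 0) = G₀ z
  initial_upper : ∀ z, upperEnv (spaceTime d) G (z, 0) ≤ upperEnv univ G₀ z
  initial_lower : ∀ z, lowerEnv univ G₀ z ≤ lowerEnv (spaceTime d) G (z, 0)
  subsolution : ∀ p : Pt d × ℝ, 0 < p.2 → ∀ φ : Pt d × ℝ → ℝ, ContDiffAt ℝ 1 φ p →
    IsLocalMax (fun q => upperEnv (spaceTime d) G q - φ q) p → gOperator ε α u φ p ≤ 0
  supersolution : ∀ p : Pt d × ℝ, 0 < p.2 → ∀ φ : Pt d × ℝ → ℝ, ContDiffAt ℝ 1 φ p →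
    IsLocalMin (fun q => lowerEnv (spaceTime d) G q - φ q) p → 0 ≤ gOperator ε α u φ p

/-- The continuous function `ρ` is a viscosity solution of `ε b · ∇ρ + |∇ρ| = 1` in the open
set `U`. -/
structure SolvesEikonal {d : ℕ} (ε : ℝ) (b : Pt d → Pt d) (U : Set (Pt d)) (ρ : Pt d → ℝ) :
    Prop where
  continuousOn : ContinuousOn ρ U
  subsolution : ∀ z ∈ U, ∀ φ : Pt d → ℝ, ContDiffAt ℝ 1 φ z →
    IsLocalMax (fun z' => ρ z' - φ z') z → ε * ⟪b z, gradient φ z⟫ + ‖gradient φ z‖ ≤ 1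
  supersolution : ∀ z ∈ U, ∀ φ : Pt d → ℝ, ContDiffAt ℝ 1 φ z →
    IsLocalMin (fun z' => ρ z' - φ z') z → 1 ≤ ε * ⟪b z, gradient φ z⟫ + ‖gradient φ z‖

/-! ### Perturbed traveling waves -/

/-- The globally Lipschitz solution of the planar metric problem `ε b · ∇ρ + |∇ρ| = 1`,
`ρ = 0` on `{y = 0}`.  The two half spaces are treated symmetrically: `ρ` is a viscosity solution
above the plane, and below the plane `-ρ` is a viscosity solution of the problem with `b` replaced
by `-b`, which is the same equation for `ρ`. -/
structure IsPlanarMetricSolution {d : ℕ} (ε : ℝ) (b : Pt d → Pt d) (ρ : Pt d → ℝ) : Prop where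
  lipschitz : ∃ K, LipschitzWith K ρ
  zero : ∀ z : Pt d, z.snd = 0 → ρ z = 0
  above : SolvesEikonal ε b {z | 0 < z.snd} ρ
  below : SolvesEikonal ε (fun z => -b z) {z | z.snd < 0} (fun z => -ρ z)
  liminf_nonneg : ∀ δ > 0, ∃ R : ℝ, ∀ z : Pt d, R ≤ z.snd → -δ ≤ ρ z
  limsup_nonpos : ∀ δ > 0, ∃ R : ℝ, ∀ z : Pt d, z.snd ≤ -R → ρ z ≤ δ

/-- `y - t + ε^{2/3} χ(x, ε^{2/3} y, ε^{2/3} t)`. -/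
def ptw {d : ℕ} (ε : ℝ) (χ : Tr d × ℝ × ℝ → ℝ) (p : Pt d × ℝ) : ℝ :=
  p.1.snd - p.2 + ε ^ (2 / 3 : ℝ)
    * χ (p.1.fst, ε ^ (2 / 3 : ℝ) * p.1.snd, ε ^ (2 / 3 : ℝ) * p.2)

/-- `ptw ε χ` is a perturbed traveling wave: it solves the G-equation and starts from a front-like
datum. -/
structure IsPerturbedTravelingWave {d : ℕ} (ε : ℝ) (α : ℝ≥0∞) (u : Pt d → ℝ → Pt d)
    (χ : Tr d × ℝ × ℝ → ℝ) : Prop where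
  solves : SolvesGEquation ε α u (fun z => ptw ε χ (z, 0)) (ptw ε χ)
  frontLike : IsFrontLike (fun z : Pt d => ptw ε χ (z, 0))

/-- The front at time `t`, i.e. the zero level set. -/
def front {d : ℕ} (t : ℝ) (G : Pt d × ℝ → ℝ) : Set (Pt d) := {z | G (z, t) = 0}

/-- The zero sub-level set in `ℝ^{d+1} × [0, ∞)`. -/
def subLevel {d : ℕ} (G : Pt d × ℝ → ℝ) : Set (Pt d × ℝ) := {p | p ∈ spaceTime d ∧ G p ≤ 0}

end GEq

end

/-!
The Hamiltonian `ξ ↦ ε u · ξ + |ξ|` is positively homogeneous, so solutions of the G-equation may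
be relabeled by increasing functions. It is also Lipschitz, so initial values propagate with finite
speed: a subsolution lies below a supersolution as soon as it does so initially on the
domain of dependence. The latter follows by doubling variables on a backward cone. If initially
`{B ≤ 0} ⊆ {A ≤ 0}` for a supersolution `B` and a subsolution `A`, then `A ≤ δ exp (N B)` holds
initially for `N` large, hence at later times, and `δ → 0` gives the inclusion at all times. For
front-like data the initial sublevel sets all equal `{y ≤ 0}`, so the sublevel sets of any two
solutions agree. Exchanging `G` with `-G` treats the superlevel sets.

A solution `ρ` of the planar metric problem is touched from below only by functions with
`|∇φ| ≥ 1 / (1 + C)`, where `ε |u| ≤ C`. Comparison with parabolas in `y` therefore forces `ρ` to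
grow at least linearly away from the plane, so `ρ` is front-like.
-/

noncomputable section

open scoped NNReal

namespace GEq

section SmoothDist

variable {E : Type*} [NormedAddCommGroup E]

/-- A smooth substitute for the distance to `a`: it dominates the distance and is `1`-Lipschitz. -/
def smoothDist (a z : E) : ℝ := √(1 + ‖z - a‖ ^ 2)

lemma norm_sub_le_smoothDist (a z : E) : ‖z - a‖ ≤ smoothDist a z :=
  Real.le_sqrt_of_sq_le (by linarith)

lemma one_le_smoothDist (a z : E) : 1 ≤ smoothDist a z :=
  Real.le_sqrt_of_sq_le (by nlinarith [sq_nonneg ‖z - a‖])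

lemma smoothDist_self (a : E) : smoothDist a a = 1 := by simp [smoothDist]

variable [InnerProductSpace ℝ E]

lemma contDiff_smoothDist (a : E) {n : WithTop ℕ∞} :
    ContDiff ℝ n (smoothDist a) :=
  (contDiff_const.add ((contDiff_id.sub contDiff_const).norm_sq ℝ)).sqrt fun z =>
    (by positivity : (0 : ℝ) < 1 + ‖z - a‖ ^ 2).ne'

end SmoothDist

section Calculus

variable {E : Type*} [NormedAddCommGroup E] [InnerProductSpace ℝ E] [CompleteSpace E]

lemma hasGradientAt_add {f g : E → ℝ} {f' g' x : E} (hf : HasGradientAt f f' x)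
    (hg : HasGradientAt g g' x) : HasGradientAt (fun z => f z + g z) (f' + g') x := by
  rw [hasGradientAt_iff_hasFDerivAt] at *
  rw [map_add]
  exact hf.add hg

lemma gradient_neg (f : E → ℝ) (x : E) : gradient (fun z => -f z) x = -gradient f x := by
  simp only [gradient, fderiv_fun_neg, map_neg]

lemma hasGradientAt_comp {f : E → ℝ} {f' x : E} {F : ℝ → ℝ} {c : ℝ}
    (hF : HasDerivAt F c (f x)) (hf : HasGradientAt f f' x) :
    HasGradientAt (fun z => F (f z)) (c • f') x := by
  rw [hasGradientAt_iff_hasFDerivAt] at *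
  rw [map_smul]
  exact hF.comp_hasFDerivAt x hf

lemma hasGradientAt_norm_sub_sq (a x : E) :
    HasGradientAt (fun z => ‖z - a‖ ^ 2) ((2 : ℝ) • (x - a)) x := by
  rw [hasGradientAt_iff_hasFDerivAt]
  have h := (hasStrictFDerivAt_norm_sq (x - a)).hasFDerivAt.comp x
    ((hasFDerivAt_id x).sub_const a)
  refine h.congr_fderiv ?_
  ext y
  simp [two_mul]

lemma hasGradientAt_smoothDist (a z : E) :
    HasGradientAt (smoothDist a) ((smoothDist a z)⁻¹ • (z - a)) z := by
  have hpos : (0 : ℝ) < 1 + ‖z - a‖ ^ 2 := by positivity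
  have h := hasGradientAt_comp (F := fun s => √(1 + s)) (f := fun z => ‖z - a‖ ^ 2)
    (((hasDerivAt_id (‖z - a‖ ^ 2)).const_add 1).sqrt hpos.ne') (hasGradientAt_norm_sub_sq a z)
  have hcoeff : (smoothDist a z)⁻¹ • (z - a)
      = (1 / (2 * √(1 + id (‖z - a‖ ^ 2)))) • (2 : ℝ) • (z - a) := by
    rw [smul_smul]
    congr 1
    simp only [smoothDist, id]
    field_simp
  rw [hcoeff]
  exact h

lemma norm_gradient_smoothDist_le_one (a z : E) :
    ‖gradient (smoothDist a) z‖ ≤ 1 := by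
  have h := one_le_smoothDist a z
  rw [(hasGradientAt_smoothDist a z).gradient, norm_smul, norm_inv,
    Real.norm_of_nonneg (by linarith), inv_mul_le_iff₀ (by linarith), mul_one]
  exact norm_sub_le_smoothDist a z

end Calculus

lemma exists_contDiffAt_right_inverse {f : ℝ → ℝ} {a : ℝ} (hf : ContDiffAt ℝ 1 f a)
    (hf' : deriv f a ≠ 0) :
    ∃ g : ℝ → ℝ, ContDiffAt ℝ 1 g (f a) ∧ g (f a) = a ∧ HasDerivAt g (deriv f a)⁻¹ (f a) ∧
      ∀ᶠ s in 𝓝 (f a), f (g s) = s := by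
  have hderiv : HasDerivAt f (deriv f a) a := (hf.differentiableAt one_ne_zero).hasDerivAt
  have hfderiv := hderiv.hasFDerivAt_equiv hf'
  have hg := hf.to_localInverse hfderiv one_ne_zero
  have hga := hf.localInverse_apply_image hfderiv one_ne_zero
  have hright := (hf.hasStrictFDerivAt' hfderiv one_ne_zero).eventually_right_inverse
  exact ⟨_, hg, hga, HasDerivAt.of_local_left_inverse hg.continuousAt (by rwa [hga]) hf' hright,
    hright⟩

section HamiltonJacobi

variable {E : Type*} [NormedAddCommGroup E] [InnerProductSpace ℝ E]

/-- The time derivative of `φ` at a space-time point. -/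
def timeDeriv (φ : E × ℝ → ℝ) (p : E × ℝ) : ℝ := deriv (fun s => φ (p.1, s)) p.2

lemma hasDerivAt_timeDeriv {φ : E × ℝ → ℝ} {p : E × ℝ} (hφ : DifferentiableAt ℝ φ p) :
    HasDerivAt (fun s => φ (p.1, s)) (timeDeriv φ p) p.2 :=
  (hφ.comp p.2 (by fun_prop : DifferentiableAt ℝ (fun s : ℝ => (p.1, s)) p.2)).hasDerivAt

lemma timeDeriv_add {φ ψ : E × ℝ → ℝ} {p : E × ℝ} (hφ : DifferentiableAt ℝ φ p)
    (hψ : DifferentiableAt ℝ ψ p) :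
    timeDeriv (fun q => φ q + ψ q) p = timeDeriv φ p + timeDeriv ψ p :=
  ((hasDerivAt_timeDeriv hφ).add (hasDerivAt_timeDeriv hψ)).deriv

lemma timeDeriv_comp {φ : E × ℝ → ℝ} {p : E × ℝ} {F : ℝ → ℝ} {c : ℝ}
    (hF : HasDerivAt F c (φ p)) (hφ : DifferentiableAt ℝ φ p) :
    timeDeriv (fun q => F (φ q)) p = c * timeDeriv φ p :=
  (hF.comp p.2 (hasDerivAt_timeDeriv hφ)).deriv

variable [CompleteSpace E]

/-- The gradient of `φ` in the space variable at a space-time point. -/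
def spaceGrad (φ : E × ℝ → ℝ) (p : E × ℝ) : E := gradient (fun z => φ (z, p.2)) p.1

lemma hasGradientAt_spaceGrad {φ : E × ℝ → ℝ} {p : E × ℝ} (hφ : DifferentiableAt ℝ φ p) :
    HasGradientAt (fun z => φ (z, p.2)) (spaceGrad φ p) p.1 :=
  (hφ.comp p.1 (by fun_prop : DifferentiableAt ℝ (fun z : E => (z, p.2)) p.1)).hasGradientAt

lemma spaceGrad_add {φ ψ : E × ℝ → ℝ} {p : E × ℝ} (hφ : DifferentiableAt ℝ φ p)
    (hψ : DifferentiableAt ℝ ψ p) :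
    spaceGrad (fun q => φ q + ψ q) p = spaceGrad φ p + spaceGrad ψ p :=
  (hasGradientAt_add (hasGradientAt_spaceGrad hφ) (hasGradientAt_spaceGrad hψ)).gradient

lemma spaceGrad_comp {φ : E × ℝ → ℝ} {p : E × ℝ} {F : ℝ → ℝ} {c : ℝ}
    (hF : HasDerivAt F c (φ p)) (hφ : DifferentiableAt ℝ φ p) :
    spaceGrad (fun q => F (φ q)) p = c • spaceGrad φ p :=
  (hasGradientAt_comp (f := fun z => φ (z, p.2)) hF (hasGradientAt_spaceGrad hφ)).gradient

/-- The Hamilton–Jacobi operator `φ_t + H(q, ∇φ)` at a space-time point, for a Hamiltonian `H`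
depending on the space-time point `q` and the slope. -/
def hjOperator (H : E × ℝ → E → ℝ) (φ : E × ℝ → ℝ) (p : E × ℝ) : ℝ :=
  timeDeriv φ p + H p (spaceGrad φ p)

/-- Viscosity subsolutions of `A_t + H(q, ∇A) = 0` for positive times. -/
def IsSubsolution (H : E × ℝ → E → ℝ) (A : E × ℝ → ℝ) : Prop :=
  ∀ p : E × ℝ, 0 < p.2 → ∀ φ : E × ℝ → ℝ, ContDiffAt ℝ 1 φ p →
    IsLocalMax (fun q => A q - φ q) p → hjOperator H φ p ≤ 0

/-- Viscosity supersolutions of `B_t + H(q, ∇B) = 0` for positive times. -/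
def IsSupersolution (H : E × ℝ → E → ℝ) (B : E × ℝ → ℝ) : Prop :=
  ∀ p : E × ℝ, 0 < p.2 → ∀ φ : E × ℝ → ℝ, ContDiffAt ℝ 1 φ p →
    IsLocalMin (fun q => B q - φ q) p → 0 ≤ hjOperator H φ p

lemma hjOperator_add {φ ψ : E × ℝ → ℝ} {p : E × ℝ} (H : E × ℝ → E → ℝ)
    (hφ : DifferentiableAt ℝ φ p) (hψ : DifferentiableAt ℝ ψ p) :
    hjOperator H (fun q => φ q + ψ q) p
      = timeDeriv φ p + timeDeriv ψ p + H p (spaceGrad φ p + spaceGrad ψ p) := by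
  rw [hjOperator, timeDeriv_add hφ hψ, spaceGrad_add hφ hψ]

lemma hjOperator_const_add (κ : ℝ) (H : E × ℝ → E → ℝ) (φ : E × ℝ → ℝ) (p : E × ℝ) :
    hjOperator (fun q ξ => κ + H q ξ) φ p = κ + hjOperator H φ p := by
  simp only [hjOperator]
  ring

/-- The Hamiltonian satisfied by `-A` when `A` satisfies that of `H`; passing to it exchanges
subsolutions and supersolutions. -/
def dual (H : E × ℝ → E → ℝ) (q : E × ℝ) (ξ : E) : ℝ := -H q (-ξ)

lemma hjOperator_dual_neg (H : E × ℝ → E → ℝ) (φ : E × ℝ → ℝ) (p : E × ℝ) :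
    hjOperator (dual H) (fun q => -φ q) p = -hjOperator H φ p := by
  have htime : timeDeriv (fun q => -φ q) p = -timeDeriv φ p := deriv.fun_neg
  have hspace : spaceGrad (fun q => -φ q) p = -spaceGrad φ p := gradient_neg _ _
  rw [hjOperator, hjOperator, dual, htime, hspace, neg_neg, neg_add]

lemma IsSubsolution.neg {H : E × ℝ → E → ℝ} {A : E × ℝ → ℝ} (hA : IsSubsolution H A) :
    IsSupersolution (dual H) (fun q => -A q) := by
  intro p hp φ hφ hmin
  have hmax : IsLocalMax (fun q => A q - -φ q) p := by
    filter_upwards [hmin] with q hq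
    linarith
  have h := hA p hp _ hφ.neg hmax
  have hdual := hjOperator_dual_neg H (fun q => -φ q) p
  simp only [neg_neg] at hdual
  linarith

lemma IsSupersolution.neg {H : E × ℝ → E → ℝ} {B : E × ℝ → ℝ} (hB : IsSupersolution H B) :
    IsSubsolution (dual H) (fun q => -B q) := by
  intro p hp φ hφ hmax
  have hmin : IsLocalMin (fun q => B q - -φ q) p := by
    filter_upwards [hmax] with q hq
    linarith
  have h := hB p hp _ hφ.neg hmin
  have hdual := hjOperator_dual_neg H (fun q => -φ q) p
  simp only [neg_neg] at hdual
  linarith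

/-- Solutions of a geometric equation may be relabeled: the test function of `f ∘ B` at a point
becomes a test function of `B` after composition with a local inverse of `f`. -/
lemma IsSupersolution.comp {H : E × ℝ → E → ℝ}
    (hH : ∀ q ξ (c : ℝ), 0 ≤ c → H q (c • ξ) = c * H q ξ) {B : E × ℝ → ℝ}
    (hB : IsSupersolution H B) {f : ℝ → ℝ} (hf : ContDiff ℝ 1 f) (hf' : ∀ s, 0 < deriv f s) :
    IsSupersolution H (fun q => f (B q)) := by
  intro p hp φ hφ hmin
  obtain ⟨g, hg, hgp, hg', hfg⟩ :=
    exists_contDiffAt_right_inverse hf.contDiffAt (hf' (B p)).ne'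
  set shift : ℝ := f (B p) - φ p
  have hφp : φ p + shift = f (B p) := add_sub_cancel _ _
  have hshift : ContDiffAt ℝ 1 (fun q => φ q + shift) p := hφ.add contDiffAt_const
  have hinverse : ∀ᶠ q in 𝓝 p, f (g (φ q + shift)) = φ q + shift :=
    hshift.continuousAt.eventually (by rwa [← hφp] at hfg)
  have htest : IsLocalMin (fun q => B q - g (φ q + shift)) p := by
    filter_upwards [hmin, hinverse] with q hq hfgq
    have hle : g (φ q + shift) ≤ B q := by
      rw [← (strictMono_of_deriv_pos hf').le_iff_le, hfgq]
      linarith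
    rw [hφp, hgp, sub_self]
    exact sub_nonneg.2 hle
  rw [← hφp] at hg hg'
  have hsup := hB p hp _ (hg.comp p hshift) htest
  have hinv : 0 < (deriv f (B p))⁻¹ := inv_pos.2 (hf' _)
  have hg'' : HasDerivAt (fun s => g (s + shift)) (deriv f (B p))⁻¹ (φ p) :=
    hg'.comp_add_const _ _
  have hφd := hφ.differentiableAt one_ne_zero
  have hscale : hjOperator H (fun q => g (φ q + shift)) p
      = (deriv f (B p))⁻¹ * hjOperator H φ p := by
    rw [hjOperator, timeDeriv_comp (F := fun s => g (s + shift)) hg'' hφd,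
      spaceGrad_comp (F := fun s => g (s + shift)) hg'' hφd, hH _ _ _ hinv.le, hjOperator, mul_add]
  exact nonneg_of_mul_nonneg_right (hscale ▸ hsup) hinv

end HamiltonJacobi

section Penalization

variable {X : Type*} [TopologicalSpace X] {K : Set X} {Ψ P : X → ℝ}

/-- The penalization method. A cluster point of the maximizers of `Ψ - n P` maximizes `Ψ` on
`{P = 0}`, and along the cluster the penalty `n P` becomes negligible. -/
lemma exists_isMaxOn_penalized (hK : IsCompact K) (hΨ : UpperSemicontinuousOn Ψ K)
    (hP : ContinuousOn P K) (hP₀ : ∀ x ∈ K, 0 ≤ P x) (hzero : ∃ x ∈ K, P x = 0) :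
    ∃ x ∈ K, P x = 0 ∧ (∀ y ∈ K, P y = 0 → Ψ y ≤ Ψ x) ∧
      ∀ U ∈ 𝓝 x, ∀ δ > 0, ∃ n : ℕ, ∃ y ∈ K ∩ U,
        IsMaxOn (fun y => Ψ y - n * P y) K y ∧ n * P y ≤ δ := by
  obtain ⟨x₀, hx₀, hPx₀⟩ := hzero
  have hmax (n : ℕ) : ∃ y ∈ K, IsMaxOn (fun y => Ψ y - n * P y) K y := by
    refine UpperSemicontinuousOn.exists_isMaxOn ⟨x₀, hx₀⟩ hK ?_
    have hpen : ContinuousOn (fun y => -((n : ℝ) * P y)) K := (continuousOn_const.mul hP).neg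
    simpa only [sub_eq_add_neg] using hΨ.add hpen.upperSemicontinuousOn
  choose y hyK hymax using hmax
  have hle {z : X} (hz : z ∈ K) (hPz : P z = 0) (n : ℕ) : Ψ z + n * P (y n) ≤ Ψ (y n) := by
    have h : Ψ z - n * P z ≤ Ψ (y n) - n * P (y n) := hymax n hz
    rw [hPz] at h
    linarith
  have hcluster (f : X → Prop) {x : X} (hx : MapClusterPt x atTop y) (hf : ∀ᶠ z in 𝓝[K] x, f z) :
      ∃ᶠ n in atTop, f (y n) :=
    (hx.frequently (eventually_nhdsWithin_iff.1 hf)).mono fun n hn => hn (hyK n)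
  obtain ⟨x, hxK, hx⟩ := hK.exists_mapClusterPt (f := atTop)
    (tendsto_principal.2 (Eventually.of_forall hyK))
  have hPx : P x = 0 := by
    by_contra hne
    have hpos : 0 < P x := (hP₀ x hxK).lt_of_ne' hne
    obtain ⟨M, hM⟩ := hΨ.bddAbove_of_isCompact hK
    have hfreq := hcluster _ hx ((hP x hxK).eventually_const_lt (half_lt_self hpos))
    obtain ⟨n, hPn, hn⟩ := (hfreq.and_eventually (eventually_ge_atTop
      ⌈(M - Ψ x₀ + 1) / (P x / 2)⌉₊)).exists
    have hn' : M - Ψ x₀ + 1 ≤ n * (P x / 2) := (div_le_iff₀ (by positivity)).1 (Nat.ceil_le.1 hn)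
    have hyM : Ψ (y n) ≤ M := hM ⟨_, hyK n, rfl⟩
    nlinarith [hle hx₀ hPx₀ n]
  refine ⟨x, hxK, hPx, fun z hz hPz => ?_, fun U hU δ hδ => ?_⟩
  · by_contra! hlt
    obtain ⟨n, hn⟩ := (hcluster _ hx (hΨ x hxK _ hlt)).exists
    nlinarith [hle hz hPz n, hP₀ _ (hyK n)]
  · have hnear : ∀ᶠ z in 𝓝[K] x, Ψ z < Ψ x + δ ∧ z ∈ U :=
      (hΨ x hxK _ (lt_add_of_pos_right _ hδ)).and (mem_nhdsWithin_of_mem_nhds hU)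
    obtain ⟨n, hΨn, hUn⟩ := (hcluster _ hx hnear).exists
    exact ⟨n, y n, ⟨hyK n, hUn⟩, hymax n, by linarith [hle hxK hPx n]⟩

end Penalization

section MaximumPrinciple

variable {E : Type*} [NormedAddCommGroup E]

/-- The squared Euclidean distance of space-time, a smooth penalty for doubling variables. -/
def sqDist (a q : E × ℝ) : ℝ := ‖q.1 - a.1‖ ^ 2 + (q.2 - a.2) ^ 2

lemma sqDist_comm (a q : E × ℝ) : sqDist a q = sqDist q a := by
  rw [sqDist, sqDist, norm_sub_rev, ← neg_sub a.2, neg_sq]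

lemma sqDist_nonneg (a q : E × ℝ) : 0 ≤ sqDist a q := by
  unfold sqDist
  positivity

lemma sqDist_eq_zero {a q : E × ℝ} : sqDist a q = 0 ↔ q = a := by
  rw [sqDist, add_eq_zero_iff_of_nonneg (sq_nonneg _) (sq_nonneg _), sq_eq_zero_iff, norm_eq_zero,
    sq_eq_zero_iff, sub_eq_zero, sub_eq_zero, Prod.ext_iff]

lemma dist_mul_norm_sub_le_sqDist (a q : E × ℝ) : dist q a * ‖q.1 - a.1‖ ≤ sqDist a q := by
  rw [Prod.dist_eq, dist_eq_norm, Real.dist_eq, sqDist, ← sq_abs (q.2 - a.2)]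
  rcases max_cases ‖q.1 - a.1‖ |q.2 - a.2| with ⟨h, _⟩ | ⟨h, _⟩ <;> rw [h] <;>
    nlinarith [sq_nonneg (‖q.1 - a.1‖ - |q.2 - a.2|)]

lemma timeDeriv_sqDist (a q : E × ℝ) : timeDeriv (sqDist a) q = 2 * (q.2 - a.2) := by
  have h := (((hasDerivAt_id q.2).sub_const a.2).pow 2).const_add (‖q.1 - a.1‖ ^ 2)
  exact h.deriv.trans (by simp)

lemma interior_setOf_snd_nonneg : interior {q : E × ℝ | 0 ≤ q.2} = {q | 0 < q.2} := by
  have h := isOpenMap_snd.preimage_interior_eq_interior_preimage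
    (continuous_snd : Continuous (Prod.snd : E × ℝ → ℝ)) (Ici 0)
  rw [interior_Ici] at h
  exact h.symm

variable [InnerProductSpace ℝ E]

lemma contDiff_sqDist (a : E × ℝ) : ContDiff ℝ 1 (sqDist a) :=
  ((contDiff_fst.sub contDiff_const).norm_sq ℝ).add ((contDiff_snd.sub contDiff_const).pow 2)

lemma sub_le_mul_sqDist_of_lipschitzOnWith {H : E × ℝ → E → ℝ} {C : Set (E × ℝ)} {L : ℝ≥0}
    (hL : ∀ ξ, LipschitzOnWith (L * ‖ξ‖₊) (fun q => H q ξ) C) {c : ℝ} (hc : 0 ≤ c) {q q' : E × ℝ}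
    (hq : q ∈ C) (hq' : q' ∈ C) :
    H q' (c • (2 : ℝ) • (q.1 - q'.1)) - H q (c • (2 : ℝ) • (q.1 - q'.1))
      ≤ 2 * L * (c * sqDist q' q) := by
  set ξ : E := c • (2 : ℝ) • (q.1 - q'.1) with hξ
  have hnorm : ‖ξ‖ = c * (2 * ‖q.1 - q'.1‖) := by
    rw [hξ, norm_smul, norm_smul, Real.norm_of_nonneg hc, Real.norm_two]
  calc H q' ξ - H q ξ
    _ ≤ L * ‖ξ‖ * dist q q' := by
      rw [dist_comm]
      exact (le_abs_self _).trans ((hL ξ).dist_le_mul q' hq' q hq)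
    _ = 2 * L * (c * (dist q q' * ‖q.1 - q'.1‖)) := by
      rw [hnorm]
      ring
    _ ≤ 2 * L * (c * sqDist q' q) := by
      gcongr
      exact dist_mul_norm_sub_le_sqDist q' q

variable [CompleteSpace E]

lemma spaceGrad_sqDist (a q : E × ℝ) : spaceGrad (sqDist a) q = (2 : ℝ) • (q.1 - a.1) := by
  have h := hasGradientAt_comp (f := fun z => ‖z - a.1‖ ^ 2)
    ((hasDerivAt_id _).add_const ((q.2 - a.2) ^ 2)) (hasGradientAt_norm_sub_sq a.1 q.1)
  exact h.gradient.trans (one_smul ℝ _)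

lemma hjOperator_const_mul_sqDist (H : E × ℝ → E → ℝ) (c : ℝ) (a q : E × ℝ) :
    hjOperator H (fun z => c * sqDist a z) q
      = c * (2 * (q.2 - a.2)) + H q (c • (2 : ℝ) • (q.1 - a.1)) := by
  have hd : DifferentiableAt ℝ (sqDist a) q := (contDiff_sqDist a).contDiffAt.differentiableAt
    one_ne_zero
  have hc : HasDerivAt (fun s => c * s) c (sqDist a q) := by
    simpa using (hasDerivAt_id (sqDist a q)).const_mul c
  rw [hjOperator, timeDeriv_comp hc hd, spaceGrad_comp hc hd, timeDeriv_sqDist, spaceGrad_sqDist]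

lemma le_sub_of_isLocalMax_doubling {H : E × ℝ → E → ℝ} {A B : E × ℝ → ℝ} {κ c : ℝ}
    (hA : IsSubsolution (fun q ξ => κ + H q ξ) A) (hB : IsSupersolution H B) {q q' : E × ℝ}
    (hq : 0 < q.2) (hq' : 0 < q'.2)
    (hmax : IsLocalMax (fun x : (E × ℝ) × E × ℝ => A x.1 - B x.2 - c * sqDist x.2 x.1) (q, q')) :
    κ ≤ H q' (c • (2 : ℝ) • (q.1 - q'.1)) - H q (c • (2 : ℝ) • (q.1 - q'.1)) := by
  have hmaxA : IsLocalMax (fun z => A z - c * sqDist q' z) q := by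
    filter_upwards [(Continuous.prodMk_left q').continuousAt.eventually hmax] with z hz
    linarith
  have hminB : IsLocalMin (fun z => B z - -c * sqDist q z) q' := by
    filter_upwards [(Continuous.prodMk_right q).continuousAt.eventually hmax] with z hz
    rw [sqDist_comm q z, sqDist_comm q q']
    linarith
  have hsub := hA q hq _ (contDiff_const.mul (contDiff_sqDist q')).contDiffAt hmaxA
  have hsup := hB q' hq' _ (contDiff_const.mul (contDiff_sqDist q)).contDiffAt hminB
  have hslope : -c • (2 : ℝ) • (q'.1 - q.1) = c • (2 : ℝ) • (q.1 - q'.1) := by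
    rw [← neg_sub q.1, smul_neg, smul_neg, neg_smul, neg_neg]
  rw [hjOperator_const_add, hjOperator_const_mul_sqDist] at hsub
  rw [hjOperator_const_mul_sqDist, hslope] at hsup
  linarith

/-- The maximum principle on a compact set `C`, by doubling variables: the difference of a strict
subsolution and a supersolution attains its maximum away from the interior of `C`. -/
lemma exists_isMaxOn_notMem_interior {H : E × ℝ → E → ℝ} {C : Set (E × ℝ)} (hC : IsCompact C)
    (hCne : C.Nonempty) (hCt : C ⊆ {q | 0 ≤ q.2}) {L : ℝ≥0}
    (hL : ∀ ξ, LipschitzOnWith (L * ‖ξ‖₊) (fun q => H q ξ) C) {A B : E × ℝ → ℝ} {κ : ℝ}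
    (hκ : 0 < κ) (hAC : UpperSemicontinuousOn A C) (hBC : LowerSemicontinuousOn B C)
    (hA : IsSubsolution (fun q ξ => κ + H q ξ) A) (hB : IsSupersolution H B) :
    ∃ q ∈ C, q ∉ interior C ∧ IsMaxOn (fun q => A q - B q) C q := by
  have husc : UpperSemicontinuousOn (fun x : (E × ℝ) × E × ℝ => A x.1 - B x.2) (C ×ˢ C) := by
    simp only [sub_eq_add_neg]
    exact (hAC.comp continuousOn_fst fun x hx => hx.1).add
      (hBC.neg.comp continuousOn_snd fun x hx => hx.2)
  have hcont : Continuous fun x : (E × ℝ) × E × ℝ => sqDist x.2 x.1 := by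
    unfold sqDist
    fun_prop
  obtain ⟨q₀, hq₀⟩ := hCne
  obtain ⟨⟨q, q'⟩, hqC, hzero, hmax, hnear⟩ := exists_isMaxOn_penalized (hC.prod hC) husc
    hcont.continuousOn (fun x _ => sqDist_nonneg x.2 x.1) ⟨(q₀, q₀), ⟨hq₀, hq₀⟩, by simp [sqDist]⟩
  obtain rfl : q = q' := sqDist_eq_zero.1 hzero
  refine ⟨q, hqC.1, fun hint => ?_, fun z hz => hmax (z, z) ⟨hz, hz⟩ (by simp [sqDist])⟩
  have htime : interior C ⊆ {q | 0 < q.2} :=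
    (interior_mono hCt).trans interior_setOf_snd_nonneg.subset
  have hU : interior C ×ˢ interior C ∈ 𝓝 (q, q) :=
    prod_mem_nhds (isOpen_interior.mem_nhds hint) (isOpen_interior.mem_nhds hint)
  obtain ⟨n, ⟨z, z'⟩, ⟨hzC, hzint⟩, hzmax, hpen⟩ :=
    hnear _ hU (κ / (2 * (L + 1))) (by positivity)
  have hκle := le_sub_of_isLocalMax_doubling hA hB (htime hzint.1) (htime hzint.2)
    (hzmax.isLocalMax (mem_of_superset ((isOpen_interior.prod isOpen_interior).mem_nhds hzint)
      (prod_mono interior_subset interior_subset)))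
  have hlip := sub_le_mul_sqDist_of_lipschitzOnWith hL n.cast_nonneg hzC.1 hzC.2
  have hlt : 2 * L * (n * sqDist z' z) < κ := calc
    _ ≤ 2 * L * (κ / (2 * (L + 1))) := by gcongr
    _ < κ := by
      rw [mul_div_assoc', div_lt_iff₀ (by positivity)]
      linarith
  linarith

end MaximumPrinciple

section Cone

variable {E : Type*} [NormedAddCommGroup E]

/-- Its sublevel sets are smoothed backward cones of slope `V` around `z₀`, the domains of
dependence of Hamiltonians that are `V`-Lipschitz in the slope. -/
def coneHeight (V : ℝ≥0) (z₀ : E) (q : E × ℝ) : ℝ := smoothDist z₀ q.1 + V * q.2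

lemma timeDeriv_coneHeight (V : ℝ≥0) (z₀ : E) (q : E × ℝ) : timeDeriv (coneHeight V z₀) q = V :=
  (((hasDerivAt_id q.2).const_mul (V : ℝ)).const_add (smoothDist z₀ q.1)).deriv.trans (mul_one _)

variable [InnerProductSpace ℝ E]

lemma contDiff_coneHeight (V : ℝ≥0) (z₀ : E) : ContDiff ℝ 1 (coneHeight V z₀) :=
  ((contDiff_smoothDist z₀).comp contDiff_fst).add (contDiff_const.mul contDiff_snd)

/-- The backward cone `{coneHeight V z₀ ≤ s}` in the half-space of nonnegative times. -/
def backwardCone (V : ℝ≥0) (z₀ : E) (s : ℝ) : Set (E × ℝ) := {q | 0 ≤ q.2 ∧ coneHeight V z₀ q ≤ s}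

lemma isCompact_backwardCone [ProperSpace E] {V : ℝ≥0} (hV : 0 < V) (z₀ : E) (s : ℝ) :
    IsCompact (backwardCone V z₀ s) := by
  have hclosed : IsClosed (backwardCone V z₀ s) :=
    (isClosed_le continuous_const continuous_snd).inter
      (isClosed_le (contDiff_coneHeight V z₀).continuous continuous_const)
  refine ((isCompact_closedBall z₀ s).prod (isCompact_Icc (a := 0) (b := s / V))).of_isClosed_subset
    hclosed fun q hq => ⟨?_, hq.1, ?_⟩
  · have hVt : 0 ≤ V * q.2 := mul_nonneg V.2 hq.1
    rw [mem_closedBall_iff_norm]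
    linarith [norm_sub_le_smoothDist z₀ q.1, hq.2, coneHeight.eq_1 V z₀ q]
  · rw [le_div_iff₀ (by exact_mod_cast hV)]
    linarith [one_le_smoothDist z₀ q.1, hq.2, coneHeight.eq_1 V z₀ q]

/-- A point of the cone off its interior lies on the base or on the lateral boundary. -/
lemma eq_zero_or_eq_of_notMem_interior_backwardCone {V : ℝ≥0} {z₀ : E} {s : ℝ} {q : E × ℝ}
    (hq : q ∈ backwardCone V z₀ s) (hint : q ∉ interior (backwardCone V z₀ s)) :
    q.2 = 0 ∨ coneHeight V z₀ q = s := by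
  by_contra! hne
  refine hint (mem_interior.2 ⟨{q | 0 < q.2 ∧ coneHeight V z₀ q < s}, fun z hz =>
    ⟨hz.1.le, hz.2.le⟩, ?_, hq.1.lt_of_ne' hne.1, hq.2.lt_of_ne hne.2⟩)
  exact (isOpen_lt continuous_const continuous_snd).inter
    (isOpen_lt (contDiff_coneHeight V z₀).continuous continuous_const)

/-- The penalty `κ t + F(h)`, where `h` is the height in the cone. Subtracting it makes a
subsolution strict and keeps its maxima inside the cone. -/
def conePenalty (κ : ℝ) (F : ℝ → ℝ) (V : ℝ≥0) (z₀ : E) (q : E × ℝ) : ℝ :=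
  κ * q.2 + F (coneHeight V z₀ q)

section ConePenalty

variable (κ : ℝ) {F : ℝ → ℝ} (hF : ContDiff ℝ 1 F) (V : ℝ≥0) (z₀ : E)
include hF

lemma contDiff_conePenalty : ContDiff ℝ 1 (conePenalty κ F V z₀) :=
  (contDiff_const.mul contDiff_snd).add (hF.comp (contDiff_coneHeight V z₀))

lemma timeDeriv_conePenalty (q : E × ℝ) :
    timeDeriv (conePenalty κ F V z₀) q = κ + deriv F (coneHeight V z₀ q) * V := by
  have hcone := hasDerivAt_timeDeriv
    ((contDiff_coneHeight V z₀).differentiable one_ne_zero q)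
  have h := ((hasDerivAt_id q.2).const_mul κ).add
    ((hF.differentiable one_ne_zero (coneHeight V z₀ q)).hasDerivAt.comp q.2 hcone)
  rw [timeDeriv_coneHeight, mul_one] at h
  exact h.deriv

variable [CompleteSpace E]

lemma spaceGrad_conePenalty (q : E × ℝ) :
    spaceGrad (conePenalty κ F V z₀) q
      = deriv F (coneHeight V z₀ q) • gradient (smoothDist z₀) q.1 := by
  have hdist := hasGradientAt_smoothDist z₀ q.1
  rw [hdist.gradient]
  have hF' := (hF.differentiable one_ne_zero (coneHeight V z₀ q)).hasDerivAt
  exact (hasGradientAt_comp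
    ((hF'.comp_add_const (smoothDist z₀ q.1) (V * q.2)).const_add (κ * q.2)) hdist).gradient

end ConePenalty

variable [CompleteSpace E]

lemma IsSubsolution.sub_conePenalty {H : E × ℝ → E → ℝ} {V : ℝ≥0}
    (hH : ∀ q, 0 ≤ q.2 → LipschitzWith V (H q)) {A : E × ℝ → ℝ} (hA : IsSubsolution H A)
    {F : ℝ → ℝ} (hF : ContDiff ℝ 1 F) (hFmono : Monotone F) (κ : ℝ) (z₀ : E) :
    IsSubsolution (fun q ξ => κ + H q ξ) (fun q => A q - conePenalty κ F V z₀ q) := by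
  intro p hp φ hφ hmax
  set c : ℝ := deriv F (coneHeight V z₀ p)
  have hc : 0 ≤ c := hFmono.deriv_nonneg
  have hpen := contDiff_conePenalty κ hF V z₀
  have htest : IsLocalMax (fun q => A q - (φ q + conePenalty κ F V z₀ q)) p := by
    filter_upwards [hmax] with q hq
    linarith
  have hsub := hA p hp _ (hφ.add hpen.contDiffAt) htest
  rw [hjOperator_add H (hφ.differentiableAt one_ne_zero) (hpen.differentiable one_ne_zero p),
    timeDeriv_conePenalty κ hF, spaceGrad_conePenalty κ hF] at hsub
  -- The cone is steep enough for `c V` to pay for the change of slope.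
  have hslope : H p (spaceGrad φ p)
      - H p (spaceGrad φ p + c • gradient (smoothDist z₀) p.1) ≤ c * V := calc
    _ ≤ V * dist (spaceGrad φ p) (spaceGrad φ p + c • gradient (smoothDist z₀) p.1) :=
      (le_abs_self _).trans ((hH p hp.le).dist_le_mul _ _)
    _ ≤ V * (c * 1) := by
      rw [dist_self_add_right, norm_smul, Real.norm_of_nonneg hc]
      gcongr
      exact norm_gradient_smoothDist_le_one _ _
    _ = c * V := by ring
  rw [hjOperator_const_add, hjOperator]
  linarith

end Cone

section Geometric

variable {E : Type*} [NormedAddCommGroup E] [InnerProductSpace ℝ E]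

/-- A geometric Hamiltonian: positively homogeneous in the slope, so that the level sets of
solutions evolve independently of each other, and regular enough for them to do so with finite
speed and uniquely. -/
structure IsGeometric (H : E × ℝ → E → ℝ) : Prop where
  map_smul_of_nonneg : ∀ q ξ (c : ℝ), 0 ≤ c → H q (c • ξ) = c * H q ξ
  finite_speed : ∃ V : ℝ≥0, ∀ q, 0 ≤ q.2 → LipschitzWith V (H q)
  locallyLipschitz : ∀ K ⊆ {q : E × ℝ | 0 ≤ q.2}, IsCompact K →
    ∃ L : ℝ≥0, ∀ ξ, LipschitzOnWith (L * ‖ξ‖₊) (fun q => H q ξ) K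

lemma IsGeometric.dual {H : E × ℝ → E → ℝ} (hH : IsGeometric H) : IsGeometric (dual H) where
  map_smul_of_nonneg q ξ c hc := by
    rw [GEq.dual, GEq.dual, ← smul_neg, hH.map_smul_of_nonneg q _ c hc, mul_neg]
  finite_speed := by
    obtain ⟨V, hV⟩ := hH.finite_speed
    refine ⟨V, fun q hq => .of_dist_le_mul fun ξ η => ?_⟩
    have h := (hV q hq).dist_le_mul (-ξ) (-η)
    rwa [dist_neg_neg, ← dist_neg_neg (H q (-ξ))] at h
  locallyLipschitz K hK hKc := by
    obtain ⟨L, hL⟩ := hH.locallyLipschitz K hK hKc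
    refine ⟨L, fun ξ => .of_dist_le_mul fun q hq q' hq' => ?_⟩
    have h := (hL (-ξ)).dist_le_mul q hq q' hq'
    rwa [nnnorm_neg, ← dist_neg_neg] at h

lemma exists_monotone_transition {M : ℝ} (hM : 0 ≤ M) (a : ℝ) :
    ∃ F : ℝ → ℝ, ContDiff ℝ 1 F ∧ Monotone F ∧ (∀ s, 0 ≤ F s) ∧ F a = 0 ∧ F (a + 1) = M := by
  refine ⟨fun s => M * Real.smoothTransition (s - a),
    contDiff_const.mul (Real.smoothTransition.contDiff.comp (contDiff_id.sub contDiff_const)),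
    fun s s' hs => mul_le_mul_of_nonneg_left (Real.smoothTransition.monotone (by linarith)) hM,
    fun s => mul_nonneg hM (Real.smoothTransition.nonneg _), by simp, by simp⟩

lemma exists_forall_sub_le {X : Type*} [TopologicalSpace X] {K : Set X} (hK : IsCompact K)
    {f g : X → ℝ} (hf : UpperSemicontinuousOn f K) (hg : LowerSemicontinuousOn g K) :
    ∃ M, ∀ x ∈ K, f x - g x ≤ M := by
  have husc : UpperSemicontinuousOn (fun x => f x - g x) K := by
    simp only [sub_eq_add_neg]
    exact hf.add hg.neg
  obtain ⟨M, hM⟩ := husc.bddAbove_of_isCompact hK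
  exact ⟨M, fun x hx => hM ⟨x, hx, rfl⟩⟩

variable [ProperSpace E]

lemma IsSubsolution.exists_isMaxOn_backwardCone {H : E × ℝ → E → ℝ} {A B : E × ℝ → ℝ} {V : ℝ≥0}
    (hV : 0 < V) (hH : IsGeometric H) (hHV : ∀ q, 0 ≤ q.2 → LipschitzWith V (H q))
    (hA : IsSubsolution H A) (hB : IsSupersolution H B)
    (hAC : UpperSemicontinuousOn A {q | 0 ≤ q.2}) (hBC : LowerSemicontinuousOn B {q | 0 ≤ q.2})
    {F : ℝ → ℝ} (hF : ContDiff ℝ 1 F) (hFmono : Monotone F) {κ : ℝ} (hκ : 0 < κ) (z₀ : E) {s : ℝ}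
    (hs : (backwardCone V z₀ s).Nonempty) :
    ∃ q ∈ backwardCone V z₀ s, (q.2 = 0 ∨ coneHeight V z₀ q = s) ∧
      IsMaxOn (fun q => A q - conePenalty κ F V z₀ q - B q) (backwardCone V z₀ s) q := by
  have hC : IsCompact (backwardCone V z₀ s) := isCompact_backwardCone hV _ _
  have hCt : backwardCone V z₀ s ⊆ {q | 0 ≤ q.2} := fun q hq => hq.1
  obtain ⟨L, hL⟩ := hH.locallyLipschitz _ hCt hC
  have hAC' : UpperSemicontinuousOn (fun q => A q - conePenalty κ F V z₀ q)
      (backwardCone V z₀ s) := by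
    simp only [sub_eq_add_neg]
    exact (hAC.mono hCt).add
      (contDiff_conePenalty κ hF V z₀).continuous.continuousOn.neg.upperSemicontinuousOn
  obtain ⟨q, hqC, hq, hmax⟩ := exists_isMaxOn_notMem_interior hC hs hCt hL hκ hAC' (hBC.mono hCt)
    (hA.sub_conePenalty hHV hF hFmono κ z₀) hB
  exact ⟨q, hqC, eq_zero_or_eq_of_notMem_interior_backwardCone hqC hq, hmax⟩

/-- Finite speed of propagation: only the initial values in the domain of dependence of `p`
matter. -/
lemma IsSubsolution.le_of_le_on_closedBall {H : E × ℝ → E → ℝ} {A B : E × ℝ → ℝ} {V : ℝ≥0}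
    (hV : 0 < V) (hH : IsGeometric H) (hHV : ∀ q, 0 ≤ q.2 → LipschitzWith V (H q))
    (hA : IsSubsolution H A) (hB : IsSupersolution H B)
    (hAC : UpperSemicontinuousOn A {q | 0 ≤ q.2}) (hBC : LowerSemicontinuousOn B {q | 0 ≤ q.2})
    {p : E × ℝ} (hp : 0 < p.2)
    (hinit : ∀ z ∈ Metric.closedBall p.1 (V * p.2 + 2), A (z, 0) ≤ B (z, 0)) : A p ≤ B p := by
  by_contra! hlt
  set C : Set (E × ℝ) := backwardCone V p.1 (V * p.2 + 1 + 1)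
  have hheight : coneHeight V p.1 p = V * p.2 + 1 := by rw [coneHeight, smoothDist_self, add_comm]
  have hpC : p ∈ C := ⟨hp.le, by linarith⟩
  obtain ⟨M, hM⟩ := exists_forall_sub_le (isCompact_backwardCone hV _ _)
    (hAC.mono fun q hq => hq.1) (hBC.mono fun q hq => hq.1)
  set κ : ℝ := (A p - B p) / (2 * p.2)
  have hκ : 0 < κ := div_pos (by linarith) (by positivity)
  have hκp : κ * p.2 = (A p - B p) / 2 := by
    simp only [κ]
    field_simp
  obtain ⟨F, hF, hFmono, hF₀, hFp, hFM⟩ :=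
    exists_monotone_transition (by linarith [hM p hpC] : 0 ≤ M) (V * p.2 + 1)
  obtain ⟨q, hqC, hq, hmax⟩ :=
    hA.exists_isMaxOn_backwardCone hV hH hHV hB hAC hBC hF hFmono hκ p.1 ⟨p, hpC⟩
  have hpq : A p - (κ * p.2 + F (V * p.2 + 1)) - B p
      ≤ A q - (κ * q.2 + F (coneHeight V p.1 q)) - B q := hheight ▸ hmax hpC
  have hκq : 0 ≤ κ * q.2 := mul_nonneg hκ.le hqC.1
  rcases hq with hbase | hlateral
  · have hball : q.1 ∈ Metric.closedBall p.1 (V * p.2 + 2) := by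
      rw [mem_closedBall_iff_norm]
      have hqs := hqC.2
      rw [coneHeight, hbase, mul_zero] at hqs
      linarith [norm_sub_le_smoothDist p.1 q.1]
    have hq₀ : q = (q.1, 0) := Prod.ext rfl hbase
    have hABq : A q ≤ B q := by
      rw [hq₀]
      exact hinit q.1 hball
    linarith [hF₀ (coneHeight V p.1 q)]
  · rw [hlateral] at hpq
    linarith [hM q hqC]

lemma exists_pos_forall_le_mul_exp {X : Type*} [TopologicalSpace X] {K : Set X} (hK : IsCompact K)
    {f g : X → ℝ} (hf : UpperSemicontinuousOn f K) (hg : LowerSemicontinuousOn g K)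
    (hfg : ∀ x ∈ K, g x ≤ 0 → f x ≤ 0) {δ : ℝ} (hδ : 0 < δ) :
    ∃ N > 0, ∀ x ∈ K, f x ≤ δ * Real.exp (N * g x) := by
  suffices h : ∃ N > 0, ∀ x ∈ K, δ ≤ f x → f x ≤ δ * (N * g x + 1) by
    obtain ⟨N, hN, h⟩ := h
    refine ⟨N, hN, fun x hx => ?_⟩
    rcases le_total δ (f x) with hfx | hfx
    · exact (h x hx hfx).trans (by gcongr; exact Real.add_one_le_exp _)
    rcases le_or_gt (g x) 0 with hgx | hgx
    · exact (hfg x hx hgx).trans (by positivity)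
    · exact hfx.trans (le_mul_of_one_le_right hδ.le (Real.one_le_exp (by positivity)))
  rcases (K ∩ f ⁻¹' Ici δ).eq_empty_or_nonempty with hempty | hne
  · exact ⟨1, one_pos, fun x hx hfx => (hempty.subset ⟨hx, hfx⟩).elim⟩
  obtain ⟨M, hM⟩ := hf.bddAbove_of_isCompact hK
  obtain ⟨x₀, hx₀, hmin⟩ := (hg.mono inter_subset_left).exists_isMinOn hne
    (hf.isCompact_inter_preimage_Ici hK δ)
  have hM₀ : 0 < M := (hδ.trans_le hx₀.2).trans_le (hM ⟨x₀, hx₀.1, rfl⟩)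
  have hg₀ : 0 < g x₀ := by
    by_contra! hle
    exact absurd (hfg x₀ hx₀.1 hle) (hδ.trans_le hx₀.2).not_ge
  refine ⟨M / (δ * g x₀), by positivity, fun x hx hfx => ?_⟩
  have hgx : g x₀ ≤ g x := hmin ⟨hx, hfx⟩
  calc f x
    _ ≤ δ * (M / (δ * g x₀) * g x₀) := by
      have hcancel : δ * (M / (δ * g x₀) * g x₀) = M := by field_simp
      exact (hM ⟨x, hx, rfl⟩).trans hcancel.ge
    _ ≤ δ * (M / (δ * g x₀) * g x + 1) := by
      gcongr
      exact (mul_le_mul_of_nonneg_left hgx (by positivity)).trans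
        (le_add_of_nonneg_right zero_le_one)

lemma IsSupersolution.mul_exp {H : E × ℝ → E → ℝ} {B : E × ℝ → ℝ} {S : Set (E × ℝ)}
    (hH : IsGeometric H) (hB : IsSupersolution H B) (hBC : LowerSemicontinuousOn B S) {δ N : ℝ}
    (hδ : 0 < δ) (hN : 0 < N) :
    IsSupersolution H (fun q => δ * Real.exp (N * B q)) ∧
      LowerSemicontinuousOn (fun q => δ * Real.exp (N * B q)) S := by
  set f : ℝ → ℝ := fun s => δ * Real.exp (N * s)
  have hf : ContDiff ℝ 1 f := by fun_prop
  have hf' (s : ℝ) : HasDerivAt f (δ * (Real.exp (N * s) * N)) s := by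
    simpa using ((hasDerivAt_id s).const_mul N).exp.const_mul δ
  have hpos (s : ℝ) : 0 < deriv f s := by
    rw [(hf' s).deriv]
    positivity
  exact ⟨hB.comp hH.map_smul_of_nonneg hf hpos,
    hf.continuous.comp_lowerSemicontinuousOn hBC (strictMono_of_deriv_pos hpos).monotone⟩

/-- Relabeling the supersolution by `s ↦ δ exp (N s)` with `N` large turns the inclusion of initial
sublevel sets into an inequality of initial values, up to the arbitrarily small `δ`. -/
lemma IsSubsolution.nonpos_of_nonpos {H : E × ℝ → E → ℝ} {A B : E × ℝ → ℝ} (hH : IsGeometric H)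
    (hA : IsSubsolution H A) (hB : IsSupersolution H B)
    (hAC : UpperSemicontinuousOn A {q | 0 ≤ q.2}) (hBC : LowerSemicontinuousOn B {q | 0 ≤ q.2})
    (hinit : ∀ z, B (z, 0) ≤ 0 → A (z, 0) ≤ 0) {p : E × ℝ} (hp : 0 ≤ p.2) (hBp : B p ≤ 0) :
    A p ≤ 0 := by
  rcases hp.eq_or_lt with hp₀ | hp₀
  · obtain ⟨z, t⟩ := p
    obtain rfl : 0 = t := hp₀
    exact hinit z hBp
  obtain ⟨V, hV⟩ := hH.finite_speed
  have hspeed : ∀ q : E × ℝ, 0 ≤ q.2 → LipschitzWith (V + 1) (H q) := fun q hq =>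
    (hV q hq).weaken le_self_add
  have hbase {s : Set E} : ContinuousOn (fun z : E => (z, (0 : ℝ))) s := by fun_prop
  have hmaps {s : Set E} : MapsTo (fun z : E => (z, (0 : ℝ))) s {q | 0 ≤ q.2} := fun z _ =>
    le_refl (0 : ℝ)
  refine le_of_forall_pos_le_add fun δ hδ => ?_
  obtain ⟨N, hN, hle⟩ := exists_pos_forall_le_mul_exp
    (isCompact_closedBall p.1 ((V + 1 : ℝ≥0) * p.2 + 2))
    (hAC.comp hbase hmaps) (hBC.comp hbase hmaps) (fun z _ => hinit z) hδ
  obtain ⟨hsuper, hlsc⟩ := hB.mul_exp hH hBC hδ hN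
  have hcomparison := hA.le_of_le_on_closedBall (by positivity) hH hspeed hsuper hAC hlsc hp₀ hle
  calc A p
    _ ≤ δ * Real.exp (N * B p) := hcomparison
    _ ≤ δ * 1 := by
      gcongr
      exact Real.exp_le_one_iff.2 (mul_nonpos_of_nonneg_of_nonpos hN.le hBp)
    _ = 0 + δ := by ring

lemma IsSubsolution.nonneg_of_nonneg {H : E × ℝ → E → ℝ} {A B : E × ℝ → ℝ} (hH : IsGeometric H)
    (hA : IsSubsolution H A) (hB : IsSupersolution H B)
    (hAC : UpperSemicontinuousOn A {q | 0 ≤ q.2}) (hBC : LowerSemicontinuousOn B {q | 0 ≤ q.2})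
    (hinit : ∀ z, 0 ≤ A (z, 0) → 0 ≤ B (z, 0)) {p : E × ℝ} (hp : 0 ≤ p.2) (hAp : 0 ≤ A p) :
    0 ≤ B p :=
  neg_nonpos.1 <| hB.neg.nonpos_of_nonpos hH.dual hA.neg hBC.neg hAC.neg
    (fun z hz => neg_nonpos.2 (hinit z (neg_nonpos.1 hz))) hp (neg_nonpos.2 hAp)

end Geometric

section Envelope

variable {X : Type*} [TopologicalSpace X] {S : Set X} {f : X → ℝ} {p : X}

lemma lowerEnv_eq_neg_upperEnv_neg (S : Set X) (f : X → ℝ) (p : X) :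
    lowerEnv S f p = -upperEnv S (fun q => -f q) p := by
  have hset : {a : ℝ | ∀ᶠ q in 𝓝[S] p, a ≤ f q} = -{a : ℝ | ∀ᶠ q in 𝓝[S] p, -f q ≤ a} := by
    ext a
    simp only [Set.mem_neg, mem_ofPred_eq, neg_le_neg_iff]
  rw [lowerEnv, liminf_eq, hset, Real.sSup_neg, upperEnv, limsup_eq]

lemma le_upperEnv (hp : p ∈ S) (hf : IsBoundedUnder (· ≤ ·) (𝓝[S] p) f) : f p ≤ upperEnv S f p :=
  le_limsup_of_frequently_le
    (frequently_iff.2 fun hU => ⟨p, mem_of_mem_nhdsWithin hp hU, le_rfl⟩) hf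

lemma lowerEnv_le (hp : p ∈ S) (hf : IsBoundedUnder (· ≥ ·) (𝓝[S] p) f) : lowerEnv S f p ≤ f p :=
  liminf_le_of_frequently_le
    (frequently_iff.2 fun hU => ⟨p, mem_of_mem_nhdsWithin hp hU, le_rfl⟩) hf

lemma upperEnv_le (hp : p ∈ S) {g : X → ℝ} (hf : IsBoundedUnder (· ≥ ·) (𝓝[S] p) f)
    (hg : ContinuousWithinAt g S p) (hfg : ∀ q, f q ≤ g q) : upperEnv S f p ≤ g p :=
  have := nhdsWithin_neBot_of_mem hp
  (limsup_le_limsup (Eventually.of_forall hfg) hf.isCoboundedUnder_le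
    hg.isBoundedUnder_le).trans_eq hg.limsup_eq

lemma le_lowerEnv (hp : p ∈ S) {g : X → ℝ} (hf : IsBoundedUnder (· ≤ ·) (𝓝[S] p) f)
    (hg : ContinuousWithinAt g S p) (hfg : ∀ q, g q ≤ f q) : g p ≤ lowerEnv S f p :=
  have := nhdsWithin_neBot_of_mem hp
  hg.liminf_eq.ge.trans (liminf_le_liminf (Eventually.of_forall hfg) hg.isBoundedUnder_ge
    hf.isCoboundedUnder_ge)

lemma upperSemicontinuousOn_upperEnv
    (hf : ∀ p ∈ S, ∃ C, ∀ᶠ q in 𝓝[S] p, |f q| ≤ C) : UpperSemicontinuousOn (upperEnv S f) S := by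
  intro p hp c hc
  obtain ⟨b, hpb, hbc⟩ := exists_between hc
  have hbdd : IsBoundedUnder (· ≤ ·) (𝓝[S] p) f := by
    obtain ⟨C, hC⟩ := hf p hp
    exact isBoundedUnder_of_eventually_le (hC.mono fun q hq => (abs_le.1 hq).2)
  have hlt := eventually_lt_of_limsup_lt hpb hbdd
  filter_upwards [eventually_eventually_nhdsWithin.2 hlt, self_mem_nhdsWithin] with q hq hqS
  have := nhdsWithin_neBot_of_mem hqS
  obtain ⟨C, hC⟩ := hf q hqS
  have hbelow : IsBoundedUnder (· ≥ ·) (𝓝[S] q) f :=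
    isBoundedUnder_of_eventually_ge (hC.mono fun q' hq' => (abs_le.1 hq').1)
  exact (limsup_le_of_le hbelow.isCoboundedUnder_le (hq.mono fun _ => le_of_lt)).trans_lt hbc

lemma lowerSemicontinuousOn_lowerEnv
    (hf : ∀ p ∈ S, ∃ C, ∀ᶠ q in 𝓝[S] p, |f q| ≤ C) : LowerSemicontinuousOn (lowerEnv S f) S := by
  have h := (upperSemicontinuousOn_upperEnv (f := fun q => -f q) (by simpa only [abs_neg])).neg
  exact funext (lowerEnv_eq_neg_upperEnv_neg S f) ▸ h

end Envelope

section FrontLike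

variable {d : ℕ} {g : ℝ → ℝ} {G₀ : Pt d → ℝ}

lemma IsBarrier.strictMono (hg : IsBarrier g) : StrictMono g := by
  have hcont {s : Set ℝ} : ContinuousOn g s := hg.locallyLipschitz.continuous.continuousOn
  refine StrictMonoOn.Iic_union_Ici (a := 0)
    (strictMonoOn_of_deriv_pos (convex_Iic 0) hcont fun y hy => hg.deriv_pos y ?_)
    (strictMonoOn_of_deriv_pos (convex_Ici 0) hcont fun y hy => hg.deriv_pos y ?_)
  · rw [interior_Iic] at hy
    exact hy.ne
  · rw [interior_Ici] at hy
    exact hy.ne'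

lemma IsBarrier.nonpos_iff (hg : IsBarrier g) {y : ℝ} : g y ≤ 0 ↔ y ≤ 0 := by
  rw [← hg.strictMono.le_iff_le (a := y), hg.zero]

lemma IsBarrier.nonneg_iff (hg : IsBarrier g) {y : ℝ} : 0 ≤ g y ↔ 0 ≤ y := by
  rw [← hg.strictMono.le_iff_le (b := y), hg.zero]

lemma continuous_snd_pt : Continuous fun z : Pt d => z.snd :=
  continuous_snd.comp (WithLp.prod_continuous_ofLp 2 _ _)

lemma IsFrontLike.exists_barrier_envelopes (h : IsFrontLike G₀) :
    ∃ glow gup : ℝ → ℝ, IsBarrier glow ∧ IsBarrier gup ∧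
      ∀ z : Pt d, glow z.snd ≤ lowerEnv univ G₀ z ∧ upperEnv univ G₀ z ≤ gup z.snd := by
  obtain ⟨glow, gup, hlow, hup, hG₀⟩ := h.barriers
  have hlowc : Continuous fun z : Pt d => glow z.snd :=
    hlow.locallyLipschitz.continuous.comp continuous_snd_pt
  have hupc : Continuous fun z : Pt d => gup z.snd :=
    hup.locallyLipschitz.continuous.comp continuous_snd_pt
  refine ⟨glow, gup, hlow, hup, fun z => ⟨?_, ?_⟩⟩
  · exact le_lowerEnv (mem_univ z) (hupc.continuousWithinAt.isBoundedUnder_le.mono_le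
      (Eventually.of_forall fun z => (hG₀ z).2)) hlowc.continuousWithinAt fun z => (hG₀ z).1
  · exact upperEnv_le (mem_univ z) (hlowc.continuousWithinAt.isBoundedUnder_ge.mono_ge
      (Eventually.of_forall fun z => (hG₀ z).1)) hupc.continuousWithinAt fun z => (hG₀ z).2

end FrontLike

section GEquation

lemma isGeometric_inner_add_norm {E : Type*} [NormedAddCommGroup E] [InnerProductSpace ℝ E]
    {v : E × ℝ → E} {C : ℝ} (hbound : ∀ q, 0 ≤ q.2 → ‖v q‖ ≤ C)
    (hlip : ∀ K ⊆ {q : E × ℝ | 0 ≤ q.2}, IsCompact K → ∃ L, LipschitzOnWith L v K) :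
    IsGeometric fun q ξ => ⟪v q, ξ⟫ + ‖ξ‖ where
  map_smul_of_nonneg q ξ c hc := by
    rw [inner_smul_right, norm_smul, Real.norm_of_nonneg hc, mul_add]
  finite_speed := by
    refine ⟨C.toNNReal + 1, fun q hq => .add (.of_dist_le_mul fun ξ η => ?_) lipschitzWith_one_norm⟩
    calc dist ⟪v q, ξ⟫ ⟪v q, η⟫
      _ = |⟪v q, ξ - η⟫| := by rw [inner_sub_right, Real.dist_eq]
      _ ≤ ‖v q‖ * ‖ξ - η‖ := abs_real_inner_le_norm _ _
      _ ≤ C.toNNReal * dist ξ η := by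
        rw [dist_eq_norm]
        gcongr
        exact (hbound q hq).trans (Real.le_coe_toNNReal C)
  locallyLipschitz K hK hKc := by
    obtain ⟨L, hL⟩ := hlip K hK hKc
    refine ⟨L, fun ξ => .of_dist_le_mul fun q hq q' hq' => ?_⟩
    calc dist (⟪v q, ξ⟫ + ‖ξ‖) (⟪v q', ξ⟫ + ‖ξ‖)
      _ = |⟪v q - v q', ξ⟫| := by rw [dist_add_right, inner_sub_left, Real.dist_eq]
      _ ≤ ‖v q - v q'‖ * ‖ξ‖ := abs_real_inner_le_norm _ _
      _ ≤ L * dist q q' * ‖ξ‖ := by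
        rw [← dist_eq_norm]
        gcongr
        exact hL.dist_le_mul q hq q' hq'
      _ = (L * ‖ξ‖₊ : ℝ≥0) * dist q q' := by
        push_cast
        ring

lemma epsPow_nonneg {ε : ℝ} (hε : 0 ≤ ε) (α : ℝ≥0∞) : 0 ≤ epsPow ε α := by
  unfold epsPow
  split_ifs
  · exact le_rfl
  · exact Real.rpow_nonneg hε _

variable {d : ℕ} {ε C : ℝ} {α : ℝ≥0∞} {u : Pt d → ℝ → Pt d}

/-- The Hamiltonian of the G-equation. -/
def gHamiltonian (ε : ℝ) (α : ℝ≥0∞) (u : Pt d → ℝ → Pt d) (q : Pt d × ℝ) (ξ : Pt d) : ℝ :=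
  ⟪ε • u q.1 (epsPow ε α * q.2), ξ⟫ + ‖ξ‖

lemma hjOperator_gHamiltonian (ε : ℝ) (α : ℝ≥0∞) (u : Pt d → ℝ → Pt d) (φ : Pt d × ℝ → ℝ)
    (p : Pt d × ℝ) : hjOperator (gHamiltonian ε α u) φ p = gOperator ε α u φ p := by
  rw [hjOperator, gHamiltonian, real_inner_smul_left, ← add_assoc]
  rfl

lemma isGeometric_gHamiltonian (hε : 0 ≤ ε)
    (hu : LocallyLipschitzOn (spaceTime d) fun q => u q.1 q.2)
    (hbound : ∀ z t, 0 ≤ t → ε * ‖u z t‖ ≤ C) : IsGeometric (gHamiltonian ε α u) := by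
  have htime {t : ℝ} (ht : 0 ≤ t) : 0 ≤ epsPow ε α * t := mul_nonneg (epsPow_nonneg hε α) ht
  refine isGeometric_inner_add_norm (C := C) (fun q hq => ?_) fun K hK hKc => ?_
  · rw [norm_smul, Real.norm_of_nonneg hε]
    exact hbound _ _ (htime hq)
  · set T : Pt d × ℝ → Pt d × ℝ := fun q => (q.1, epsPow ε α * q.2)
    have hT : LipschitzWith (max 1 (‖epsPow ε α‖₊ * 1)) T :=
      LipschitzWith.prod_fst.prodMk ((lipschitzWith_smul _).comp LipschitzWith.prod_snd)
    have hTK : T '' K ⊆ spaceTime d := image_subset_iff.2 fun q hq => htime (hK hq)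
    obtain ⟨L, hL⟩ := (hu.mono hTK).exists_lipschitzOnWith_of_compact (hKc.image hT.continuous)
    have hLT : LipschitzOnWith (L * max 1 (‖epsPow ε α‖₊ * 1)) (fun q => u (T q).1 (T q).2) K :=
      hL.comp hT.lipschitzOnWith (mapsTo_image T K)
    exact ⟨‖ε‖₊ * (L * max 1 (‖epsPow ε α‖₊ * 1)), (lipschitzWith_smul ε).comp_lipschitzOnWith hLT⟩

lemma locallyLipschitzOn_advection {uperp : Tr d × ℝ × ℝ → Tr d}
    (huperp : ContDiffOn ℝ 1 uperp {q | 0 ≤ q.2.2}) {upar : Tr d × ℝ → ℝ}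
    (hupar : ContDiffOn ℝ 1 upar {q | 0 ≤ q.2}) {v : ℝ → ℝ} (hv : ContDiff ℝ 1 v) :
    LocallyLipschitzOn (spaceTime d) fun q => advection uperp upar v q.1 q.2 := by
  have hfst : ContDiff ℝ 1 fun q : Pt d × ℝ => q.1.fst :=
    (WithLp.fstL 2 ℝ (Tr d) ℝ).contDiff.comp contDiff_fst
  have hsnd : ContDiff ℝ 1 fun q : Pt d × ℝ => q.1.snd :=
    (WithLp.sndL 2 ℝ (Tr d) ℝ).contDiff.comp contDiff_fst
  have hperp : ContDiffOn ℝ 1 (fun q => uperp (q.1.fst, q.1.snd, q.2)) (spaceTime d) :=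
    huperp.comp (hfst.prodMk (hsnd.prodMk contDiff_snd)).contDiffOn fun q hq => hq
  have hpar : ContDiffOn ℝ 1 (fun q => upar (q.1.fst, q.2) * v q.1.snd) (spaceTime d) :=
    (hupar.comp (hfst.prodMk contDiff_snd).contDiffOn fun q hq => hq).mul
      (hv.comp hsnd).contDiffOn
  have hadv : ContDiffOn ℝ 1 (fun q => advection uperp upar v q.1 q.2) (spaceTime d) :=
    (WithLp.prodContinuousLinearEquiv 2 ℝ (Tr d) ℝ).symm.contDiff.comp_contDiffOn
      (hperp.prodMk hpar)
  have hconvex : Convex ℝ (spaceTime d) :=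
    convex_halfSpace_ge (LinearMap.snd ℝ (Pt d) ℝ).isLinear 0
  exact fun q hq => (hadv q hq).exists_lipschitzOnWith hconvex

variable {G₀ G₀' : Pt d → ℝ} {G G' : Pt d × ℝ → ℝ}

lemma SolvesGEquation.isSubsolution (hG : SolvesGEquation ε α u G₀ G) :
    IsSubsolution (gHamiltonian ε α u) (upperEnv (spaceTime d) G) := fun p hp φ hφ hmax =>
  (hjOperator_gHamiltonian ε α u φ p).trans_le (hG.subsolution p hp φ hφ hmax)

lemma SolvesGEquation.isSupersolution (hG : SolvesGEquation ε α u G₀ G) :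
    IsSupersolution (gHamiltonian ε α u) (lowerEnv (spaceTime d) G) := fun p hp φ hφ hmin =>
  (hG.supersolution p hp φ hφ hmin).trans_eq (hjOperator_gHamiltonian ε α u φ p).symm

lemma SolvesGEquation.exists_eventually_abs_le (hG : SolvesGEquation ε α u G₀ G) (p : Pt d × ℝ) :
    ∃ C, ∀ᶠ q in 𝓝[spaceTime d] p, |G q| ≤ C := by
  have hclosed : IsClosed (spaceTime d) := isClosed_le continuous_const continuous_snd
  obtain ⟨C, hC⟩ := hG.locallyBounded (spaceTime d ∩ Metric.closedBall p 1) inter_subset_left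
    ((isCompact_closedBall p 1).inter_left hclosed)
  exact ⟨C, mem_of_superset (inter_mem_nhdsWithin _ (Metric.closedBall_mem_nhds p one_pos)) hC⟩

lemma SolvesGEquation.le_upperEnv (hG : SolvesGEquation ε α u G₀ G) {p : Pt d × ℝ}
    (hp : p ∈ spaceTime d) : G p ≤ upperEnv (spaceTime d) G p := by
  obtain ⟨C, hC⟩ := hG.exists_eventually_abs_le p
  exact GEq.le_upperEnv hp (isBoundedUnder_of_eventually_le (hC.mono fun q hq => (abs_le.1 hq).2))

lemma SolvesGEquation.lowerEnv_le (hG : SolvesGEquation ε α u G₀ G) {p : Pt d × ℝ}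
    (hp : p ∈ spaceTime d) : lowerEnv (spaceTime d) G p ≤ G p := by
  obtain ⟨C, hC⟩ := hG.exists_eventually_abs_le p
  exact GEq.lowerEnv_le hp (isBoundedUnder_of_eventually_ge (hC.mono fun q hq => (abs_le.1 hq).1))

lemma SolvesGEquation.nonpos_of_nonpos (hH : IsGeometric (gHamiltonian ε α u))
    (hG : SolvesGEquation ε α u G₀ G) (hG' : SolvesGEquation ε α u G₀' G') (hG₀ : IsFrontLike G₀)
    (hG₀' : IsFrontLike G₀') {p : Pt d × ℝ} (hp : p ∈ spaceTime d) (hG'p : G' p ≤ 0) :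
    G p ≤ 0 := by
  obtain ⟨_, gup, _, hup, henv⟩ := hG₀.exists_barrier_envelopes
  obtain ⟨glow, _, hlow, _, henv'⟩ := hG₀'.exists_barrier_envelopes
  refine (hG.le_upperEnv hp).trans (hG.isSubsolution.nonpos_of_nonpos hH hG'.isSupersolution
    (upperSemicontinuousOn_upperEnv fun p _ => hG.exists_eventually_abs_le p)
    (lowerSemicontinuousOn_lowerEnv fun p _ => hG'.exists_eventually_abs_le p) (fun z hz => ?_) hp
    ((hG'.lowerEnv_le hp).trans hG'p))
  have hy : z.snd ≤ 0 := hlow.nonpos_iff.1 ((henv' z).1.trans ((hG'.initial_lower z).trans hz))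
  exact (hG.initial_upper z).trans ((henv z).2.trans (hup.nonpos_iff.2 hy))

lemma SolvesGEquation.nonneg_of_nonneg (hH : IsGeometric (gHamiltonian ε α u))
    (hG : SolvesGEquation ε α u G₀ G) (hG' : SolvesGEquation ε α u G₀' G') (hG₀ : IsFrontLike G₀)
    (hG₀' : IsFrontLike G₀') {p : Pt d × ℝ} (hp : p ∈ spaceTime d) (hGp : 0 ≤ G p) :
    0 ≤ G' p := by
  obtain ⟨_, gup, _, hup, henv⟩ := hG₀.exists_barrier_envelopes
  obtain ⟨glow, _, hlow, _, henv'⟩ := hG₀'.exists_barrier_envelopes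
  refine (hG.isSubsolution.nonneg_of_nonneg hH hG'.isSupersolution
    (upperSemicontinuousOn_upperEnv fun p _ => hG.exists_eventually_abs_le p)
    (lowerSemicontinuousOn_lowerEnv fun p _ => hG'.exists_eventually_abs_le p) (fun z hz => ?_) hp
    (hGp.trans (hG.le_upperEnv hp))).trans (hG'.lowerEnv_le hp)
  have hy : 0 ≤ z.snd := hup.nonneg_iff.1 (hz.trans ((hG.initial_upper z).trans (henv z).2))
  exact (hlow.nonneg_iff.2 hy).trans ((henv' z).1.trans (hG'.initial_lower z))

variable (hH : IsGeometric (gHamiltonian ε α u)) (hG : SolvesGEquation ε α u G₀ G)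
  (hG' : SolvesGEquation ε α u G₀' G') (hG₀ : IsFrontLike G₀) (hG₀' : IsFrontLike G₀')
include hH hG hG' hG₀ hG₀'

lemma subLevel_eq_of_isFrontLike : subLevel G = subLevel G' := by
  ext p
  exact and_congr_right fun hp => ⟨hG'.nonpos_of_nonpos hH hG hG₀' hG₀ hp,
    hG.nonpos_of_nonpos hH hG' hG₀ hG₀' hp⟩

lemma front_eq_of_isFrontLike {t : ℝ} (ht : 0 ≤ t) : front t G = front t G' := by
  ext z
  have hp : (z, t) ∈ spaceTime d := ht
  have hnonpos : G (z, t) ≤ 0 ↔ G' (z, t) ≤ 0 :=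
    ⟨hG'.nonpos_of_nonpos hH hG hG₀' hG₀ hp, hG.nonpos_of_nonpos hH hG' hG₀ hG₀' hp⟩
  have hnonneg : 0 ≤ G (z, t) ↔ 0 ≤ G' (z, t) :=
    ⟨hG.nonneg_of_nonneg hH hG' hG₀ hG₀' hp, hG'.nonneg_of_nonneg hH hG hG₀' hG₀ hp⟩
  exact le_antisymm_iff.trans ((and_congr hnonpos hnonneg).trans le_antisymm_iff.symm)

end GEquation

section HalfSpace

variable {E : Type*} [NormedAddCommGroup E]

/-- The penalty `η * smoothDist a` makes a minimum exist on a noncompact set. -/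
lemma exists_isLocalMin_add_smoothDist [ProperSpace E] {T U : Set E} (hT : IsClosed T)
    (hU : IsOpen U) (hUT : U ⊆ T) {F : E → ℝ} (hF : Continuous F) {c η : ℝ}
    (hc : ∀ z ∈ T, c ≤ F z) (hη : 0 < η) {a : E} (ha : a ∈ T)
    (hboundary : ∀ z ∈ T \ U, F a + η ≤ F z) :
    ∃ z ∈ U, IsLocalMin (fun z' => F z' + η * smoothDist a z') z := by
  have hcont : Continuous fun z => F z + η * smoothDist a z := by
    unfold smoothDist
    fun_prop
  have hcoercive : ∀ᶠ z in cocompact E ⊓ 𝓟 T, F a + η * smoothDist a a ≤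
      F z + η * smoothDist a z := by
    refine eventually_inf_principal.2 ?_
    filter_upwards [(tendsto_dist_right_cocompact_atTop a).eventually_ge_atTop
      ((F a + η * smoothDist a a - c) / η)] with z hz hzT
    rw [dist_eq_norm, div_le_iff₀' hη] at hz
    have hdist := mul_le_mul_of_nonneg_left (norm_sub_le_smoothDist a z) hη.le
    linarith [hc z hzT]
  obtain ⟨z, hzT, hmin⟩ := hcont.continuousOn.exists_isMinOn' hT ha hcoercive
  have hz : z ∈ U := by
    by_contra hz
    have hle : F z + η * smoothDist a z ≤ F a + η * smoothDist a a := hmin ha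
    rw [smoothDist_self, mul_one] at hle
    have hpos : 0 < η * smoothDist a z := mul_pos hη (one_pos.trans_le (one_le_smoothDist a z))
    linarith [hboundary z ⟨hzT, hz⟩]
  exact ⟨z, hz, hmin.isLocalMin (mem_of_superset (hU.mem_nhds hz) hUT)⟩

variable [InnerProductSpace ℝ E]

lemma abs_le_mul_abs_inner {e : E} (he : ‖e‖ = 1) {ρ : E → ℝ} {K : ℝ≥0} (hK : LipschitzWith K ρ)
    (hρ : ∀ z, ⟪e, z⟫ = 0 → ρ z = 0) (z : E) : |ρ z| ≤ K * |⟪e, z⟫| := by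
  have hproj : ρ (z - ⟪e, z⟫ • e) = 0 := by
    refine hρ _ ?_
    rw [inner_sub_right, inner_smul_right, real_inner_self_eq_norm_sq, he]
    ring
  calc |ρ z|
    _ = ‖ρ z - ρ (z - ⟪e, z⟫ • e)‖ := by rw [hproj, sub_zero, Real.norm_eq_abs]
    _ ≤ K * ‖z - (z - ⟪e, z⟫ • e)‖ := hK.norm_sub_le _ _
    _ = K * |⟪e, z⟫| := by rw [sub_sub_cancel, norm_smul, he, mul_one, Real.norm_eq_abs]

/-- The function `s (y - y² / R)` of the height `y = ⟪e, z⟫`: it vanishes for `y = 0` and `y = R`,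
and its slope is at most `s` in between. -/
def heightParabola (e : E) (s R : ℝ) (z : E) : ℝ := s * (⟪e, z⟫ - ⟪e, z⟫ ^ 2 / R)

variable {e : E} {s R : ℝ}

lemma contDiff_heightParabola : ContDiff ℝ 1 (heightParabola e s R) := by
  have hinner : ContDiff ℝ 1 fun z : E => ⟪e, z⟫ := contDiff_const.inner ℝ contDiff_id
  exact contDiff_const.mul (hinner.sub ((hinner.pow 2).div_const R))

lemma heightParabola_le (hs : 0 ≤ s) {z : E} (hz : ⟪e, z⟫ ∈ Icc 0 R) :
    heightParabola e s R z ≤ s * R := by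
  refine mul_le_mul_of_nonneg_left ?_ hs
  linarith [div_nonneg (sq_nonneg ⟪e, z⟫) (hz.1.trans hz.2), hz.2]

variable [ProperSpace E]

lemma norm_gradient_heightParabola_sub_smoothDist_le (he : ‖e‖ = 1) (a : E) {z : E} {η : ℝ}
    (hs : 0 ≤ s) (hη : 0 ≤ η) (hz : ⟪e, z⟫ ∈ Icc 0 R) :
    ‖gradient (fun z => heightParabola e s R z + -η * smoothDist a z) z‖ ≤ s + η := by
  have hinner : HasGradientAt (fun z : E => ⟪e, z⟫) e z :=
    hasGradientAt_iff_hasFDerivAt.2 (InnerProductSpace.toDual ℝ E e).hasFDerivAt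
  have hparabola : HasDerivAt (fun y => s * (y - y ^ 2 / R)) (s * (1 - 2 * ⟪e, z⟫ / R)) ⟪e, z⟫ := by
    simpa using ((hasDerivAt_id ⟪e, z⟫).sub (((hasDerivAt_id ⟪e, z⟫).pow 2).div_const R)).const_mul
      s
  have hdist := (hasGradientAt_smoothDist a z).differentiableAt.hasGradientAt
  have hgrad : HasGradientAt (fun z => heightParabola e s R z + -η * smoothDist a z)
      ((s * (1 - 2 * ⟪e, z⟫ / R)) • e + -η • gradient (smoothDist a) z) z :=
    hasGradientAt_add (hasGradientAt_comp (f := fun z => ⟪e, z⟫) hparabola hinner)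
      (hasGradientAt_comp (hasDerivAt_const_mul (-η)) hdist)
  rw [hgrad.gradient]
  have hslope : |1 - 2 * ⟪e, z⟫ / R| ≤ 1 := by
    have h0 : 0 ≤ ⟪e, z⟫ / R := div_nonneg hz.1 (hz.1.trans hz.2)
    have h1 : ⟪e, z⟫ / R ≤ 1 := div_le_one_of_le₀ hz.2 (hz.1.trans hz.2)
    rw [mul_div_assoc, abs_le]
    constructor <;> linarith
  refine norm_add_le_of_le ?_ ?_
  · rw [norm_smul, he, mul_one, Real.norm_eq_abs, abs_mul, abs_of_nonneg hs]
    exact mul_le_of_le_one_right hs hslope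
  · rw [norm_smul, norm_neg, Real.norm_of_nonneg hη]
    exact mul_le_of_le_one_right hη (norm_gradient_smoothDist_le_one a z)

variable {ρ : E → ℝ} {K : ℝ≥0} {m : ℝ}

/-- Compares `ρ` with a parabola in the height, whose slope `s < m` cannot be attained by a test
function. -/
lemma heightParabola_sub_le_of_le_norm_gradient (he : ‖e‖ = 1) (hρ : Continuous ρ)
    (hgrowth : ∀ z, 0 ≤ ⟪e, z⟫ → -(K * ⟪e, z⟫) ≤ ρ z)
    (hgrad : ∀ z, 0 < ⟪e, z⟫ → ∀ φ : E → ℝ, ContDiffAt ℝ 1 φ z →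
      IsLocalMin (fun z' => ρ z' - φ z') z → m ≤ ‖gradient φ z‖)
    {δ : ℝ} (hs : 0 ≤ s) (hsm : s < m) (hδ : 0 ≤ δ) (hR : ∀ z, ⟪e, z⟫ = R → -δ ≤ ρ z) {a : E}
    (ha : ⟪e, a⟫ ∈ Icc 0 R) : heightParabola e s R a - δ ≤ ρ a := by
  by_contra! hlt
  have hinner : Continuous fun z : E => ⟪e, z⟫ := by fun_prop
  set F : E → ℝ := fun z => ρ z - heightParabola e s R z
  set slab : Set E := {z | ⟪e, z⟫ ∈ Icc 0 R}
  obtain ⟨η, hη, hηm, hηF⟩ : ∃ η, 0 < η ∧ s + η < m ∧ F a + η ≤ -δ := by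
    refine ⟨min ((m - s) / 2) (-δ - F a), lt_min (by linarith) (by linarith), ?_, ?_⟩
    · linarith [min_le_left ((m - s) / 2) (-δ - F a)]
    · linarith [min_le_right ((m - s) / 2) (-δ - F a)]
  have hbelow : ∀ z ∈ slab, -(K * R) - s * R ≤ F z := by
    intro z hz
    have hK : K * ⟪e, z⟫ ≤ K * R := by gcongr; exact hz.2
    linarith [hgrowth z hz.1, heightParabola_le hs hz]
  have hboundary : ∀ z ∈ slab \ {z | ⟪e, z⟫ ∈ Ioo 0 R}, F a + η ≤ F z := by
    intro z ⟨⟨hz, hzR⟩, hzIoo⟩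
    refine hηF.trans ?_
    rcases hz.eq_or_lt with h0 | hpos
    · have hρz : 0 ≤ ρ z := by simpa [← h0] using hgrowth z hz
      simpa [F, heightParabola, ← h0] using (neg_nonpos.2 hδ).trans hρz
    · have hzeq : ⟪e, z⟫ = R := hzR.eq_of_not_lt fun hlt => hzIoo ⟨hpos, hlt⟩
      simpa [F, heightParabola, hzeq, sq] using hR z hzeq
  obtain ⟨z, hz, hmin⟩ := exists_isLocalMin_add_smoothDist
    (isClosed_Icc.preimage hinner) (isOpen_Ioo.preimage hinner)
    (preimage_mono Ioo_subset_Icc_self) (hρ.sub contDiff_heightParabola.continuous) hbelow hη ha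
    hboundary
  have htest : ContDiff ℝ 1 fun z => heightParabola e s R z + -η * smoothDist a z :=
    contDiff_heightParabola.add (contDiff_const.mul (contDiff_smoothDist a))
  have hlower : m ≤ ‖gradient _ z‖ := hgrad z hz.1 _ htest.contDiffAt <| hmin.congr <|
    .of_forall fun z' => by simp only [Pi.sub_apply]; ring
  have hupper := norm_gradient_heightParabola_sub_smoothDist_le he a hs hη.le
    (Ioo_subset_Icc_self hz)
  linarith

lemma mul_inner_le_of_le_norm_gradient (he : ‖e‖ = 1) (hρ : Continuous ρ)
    (hgrowth : ∀ z, 0 ≤ ⟪e, z⟫ → -(K * ⟪e, z⟫) ≤ ρ z)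
    (hm : 0 < m) (hgrad : ∀ z, 0 < ⟪e, z⟫ → ∀ φ : E → ℝ, ContDiffAt ℝ 1 φ z →
      IsLocalMin (fun z' => ρ z' - φ z') z → m ≤ ‖gradient φ z‖)
    (hinf : ∀ δ > 0, ∃ R : ℝ, ∀ z, R ≤ ⟪e, z⟫ → -δ ≤ ρ z) {z : E} (hz : 0 ≤ ⟪e, z⟫) :
    m * ⟪e, z⟫ ≤ ρ z := by
  have hslope : ∀ s ∈ Ico 0 m, s * ⟪e, z⟫ ≤ ρ z := fun s hs => by
    refine le_of_forall_pos_le_add fun δ hδ => ?_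
    obtain ⟨R₀, hR₀⟩ := hinf δ hδ
    have hlim : Tendsto (fun R => heightParabola e s R z) atTop (𝓝 (s * ⟪e, z⟫)) := by
      simpa [heightParabola] using ((tendsto_const_nhds (x := ⟪e, z⟫)).sub
        (tendsto_const_nhds.div_atTop tendsto_id)).const_mul s
    refine le_of_tendsto hlim ?_
    filter_upwards [eventually_ge_atTop R₀, eventually_ge_atTop ⟪e, z⟫] with R hR hzR
    exact sub_le_iff_le_add.1 (heightParabola_sub_le_of_le_norm_gradient he hρ hgrowth hgrad hs.1
      hs.2 hδ.le (fun z' hz' => hR₀ z' (hz' ▸ hR)) ⟨hz, hzR⟩)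
  have hlim : Tendsto (fun s => s * ⟪e, z⟫) (𝓝[<] m) (𝓝 (m * ⟪e, z⟫)) :=
    (tendsto_id.mul_const _).mono_left nhdsWithin_le_nhds
  refine le_of_tendsto hlim ?_
  filter_upwards [Ico_mem_nhdsLT hm] with s hs using hslope s hs

end HalfSpace

section PlanarMetric

lemma isBarrier_mul_add_mul_abs {a b : ℝ} (hab : |b| < a) :
    IsBarrier fun y => a * y + b * |y| where
  locallyLipschitz :=
    ((lipschitzWith_smul a).add
      ((lipschitzWith_smul b).comp lipschitzWith_one_norm)).locallyLipschitz
  contDiffOn y hy :=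
    ((contDiffAt_const.mul contDiffAt_id).add
      (contDiffAt_const.mul (contDiffAt_abs hy))).contDiffWithinAt
  deriv_pos y hy := by
    have hderiv : HasDerivAt (fun y => a * y + b * |y|) (a + b * SignType.sign y) y :=
      (hasDerivAt_const_mul a).add ((hasDerivAt_abs hy).const_mul b)
    rw [hderiv.deriv]
    rcases hy.lt_or_gt with hneg | hpos
    · simp [hneg, (abs_lt.1 hab).2]
    · simpa [hpos] using neg_lt_iff_pos_add'.1 (abs_lt.1 hab).1
  zero := by simp

lemma inv_one_add_le_norm {E : Type*} [NormedAddCommGroup E] [InnerProductSpace ℝ E] {b ξ : E}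
    {ε C : ℝ} (hε : 0 ≤ ε) (hb : ε * ‖b‖ ≤ C) (hξ : 1 ≤ ε * ⟪b, ξ⟫ + ‖ξ‖) : (1 + C)⁻¹ ≤ ‖ξ‖ := by
  have hC : 0 ≤ C := (by positivity : 0 ≤ ε * ‖b‖).trans hb
  have hinner : ε * ⟪b, ξ⟫ ≤ C * ‖ξ‖ :=
    calc ε * ⟪b, ξ⟫
      _ ≤ ε * (‖b‖ * ‖ξ‖) := by gcongr; exact real_inner_le_norm b ξ
      _ = ε * ‖b‖ * ‖ξ‖ := (mul_assoc _ _ _).symm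
      _ ≤ C * ‖ξ‖ := by gcongr
  rw [inv_le_iff_one_le_mul₀ (by positivity)]
  linarith

variable {d : ℕ}

/-- The unit vector in the direction of propagation `y`. -/
def vertical (d : ℕ) : Pt d := WithLp.toLp 2 (0, 1)

lemma inner_vertical (z : Pt d) : ⟪vertical d, z⟫ = z.snd := by
  simp [vertical, WithLp.prod_inner_apply]

lemma norm_vertical : ‖vertical d‖ = 1 := by simp [vertical]

variable {ε C : ℝ} {b : Pt d → Pt d} {ρ : Pt d → ℝ}

lemma SolvesEikonal.inv_one_add_le_norm_gradient {U : Set (Pt d)} (h : SolvesEikonal ε b U ρ)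
    (hε : 0 ≤ ε) (hb : ∀ z, ε * ‖b z‖ ≤ C) {z : Pt d} (hz : z ∈ U) {φ : Pt d → ℝ}
    (hφ : ContDiffAt ℝ 1 φ z) (hmin : IsLocalMin (fun z' => ρ z' - φ z') z) :
    (1 + C)⁻¹ ≤ ‖gradient φ z‖ :=
  inv_one_add_le_norm hε (hb z) (h.supersolution z hz φ hφ hmin)

namespace IsPlanarMetricSolution

lemma exists_abs_le (h : IsPlanarMetricSolution ε b ρ) : ∃ K : ℝ≥0, ∀ z, |ρ z| ≤ K * |z.snd| := by
  obtain ⟨K, hK⟩ := h.lipschitz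
  refine ⟨K, fun z => ?_⟩
  rw [← inner_vertical z]
  exact abs_le_mul_abs_inner norm_vertical hK (fun z hz => h.zero z (inner_vertical z ▸ hz)) z

lemma mul_le_of_nonneg (h : IsPlanarMetricSolution ε b ρ) (hε : 0 ≤ ε)
    (hb : ∀ z, ε * ‖b z‖ ≤ C) {z : Pt d} (hz : 0 ≤ z.snd) : (1 + C)⁻¹ * z.snd ≤ ρ z := by
  obtain ⟨K, hK⟩ := h.exists_abs_le
  have hC : 0 ≤ C := (by positivity : 0 ≤ ε * ‖b 0‖).trans (hb 0)
  rw [← inner_vertical] at hz ⊢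
  refine mul_inner_le_of_le_norm_gradient norm_vertical h.lipschitz.choose_spec.continuous
    (K := K) ?_ (by positivity) ?_ ?_ hz <;> simp only [inner_vertical]
  · intro z hz
    exact abs_of_nonneg hz ▸ (abs_le.1 (hK z)).1
  · exact fun z hz φ hφ hmin => h.above.inv_one_add_le_norm_gradient hε hb hz hφ hmin
  · exact h.liminf_nonneg

lemma le_mul_of_nonpos (h : IsPlanarMetricSolution ε b ρ) (hε : 0 ≤ ε)
    (hb : ∀ z, ε * ‖b z‖ ≤ C) {z : Pt d} (hz : z.snd ≤ 0) : ρ z ≤ (1 + C)⁻¹ * z.snd := by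
  obtain ⟨K, hK⟩ := h.exists_abs_le
  have hC : 0 ≤ C := (by positivity : 0 ≤ ε * ‖b 0‖).trans (hb 0)
  have hdown (z : Pt d) : ⟪-vertical d, z⟫ = -z.snd := by rw [inner_neg_left, inner_vertical]
  suffices (1 + C)⁻¹ * ⟪-vertical d, z⟫ ≤ -ρ z by rw [hdown] at this; linarith
  refine mul_inner_le_of_le_norm_gradient (ρ := fun z => -ρ z) ((norm_neg _).trans norm_vertical)
    h.lipschitz.choose_spec.continuous.neg (K := K) ?_ (by positivity) ?_ ?_ ?_ <;>
    simp only [hdown]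
  · intro z hz
    exact abs_of_nonpos (neg_nonneg.1 hz) ▸ neg_le_neg (abs_le.1 (hK z)).2
  · exact fun z hz φ hφ hmin => h.below.inv_one_add_le_norm_gradient hε
      (fun z => norm_neg (b z) ▸ hb z) (neg_pos.1 hz) hφ hmin
  · exact fun δ hδ => (h.limsup_nonpos δ hδ).imp fun R hR z hz =>
      neg_le_neg (hR z (le_neg_of_le_neg hz))
  · exact neg_nonneg.2 hz

lemma isFrontLike (h : IsPlanarMetricSolution ε b ρ) (hε : 0 ≤ ε) (hb : ∀ z, ε * ‖b z‖ ≤ C) :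
    IsFrontLike ρ := by
  have hC : 0 ≤ C := (by positivity : 0 ≤ ε * ‖b 0‖).trans (hb 0)
  obtain ⟨K, hK⟩ := h.exists_abs_le
  have hρ : Continuous ρ := h.lipschitz.choose_spec.continuous
  set m : ℝ := (1 + C)⁻¹
  have hm : 0 < m := by positivity
  have hslopes : |(m - (K + 1)) / 2| < (m + (K + 1)) / 2 := by
    have := K.coe_nonneg
    rw [abs_lt]
    constructor <;> linarith
  -- The lower barrier has slope `m` above the plane and `K + 1` below it, the upper one conversely.
  refine ⟨fun T hT => ?_, _, _, isBarrier_mul_add_mul_abs hslopes,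
    isBarrier_mul_add_mul_abs (b := -((m - (K + 1)) / 2)) (by rwa [abs_neg]), fun z => ?_⟩
  · obtain ⟨M, hM⟩ := hT.exists_bound_of_continuousOn hρ.continuousOn
    exact memLp_top_of_bound hρ.aestronglyMeasurable M
      (ae_restrict_of_forall_mem hT.measurableSet hM)
  · obtain ⟨hlow, hup⟩ := abs_le.1 (hK z)
    rcases le_total 0 z.snd with hz | hz
    · have := h.mul_le_of_nonneg hε hb hz
      rw [abs_of_nonneg hz] at *
      constructor <;> linarith
    · have := h.le_mul_of_nonpos hε hb hz
      rw [abs_of_nonpos hz] at *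
      constructor <;> linarith

end IsPlanarMetricSolution

end PlanarMetric

end GEq

end

theorem proposition2p2_general {d : ℕ} {u : GEq.Pt d → ℝ → GEq.Pt d} {ε C : ℝ} {α : ENNReal}
    (hu : LocallyLipschitzOn (GEq.spaceTime d) fun q => u q.1 q.2) (hε : 0 ≤ ε)
    (hbound : ∀ z t, 0 ≤ t → ε * ‖u z t‖ ≤ C) :
    (∀ (ρ : GEq.Pt d → ℝ) (χ : GEq.Tr d × ℝ × ℝ → ℝ),
      GEq.IsPlanarMetricSolution ε (fun z => u z 0) ρ →
      GEq.SolvesGEquation ε α u ρ (GEq.ptw ε χ) →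
      GEq.IsPerturbedTravelingWave ε α u χ) ∧
    (∀ (χ : GEq.Tr d × ℝ × ℝ → ℝ), GEq.IsPerturbedTravelingWave ε α u χ →
      ∀ (G₀ : GEq.Pt d → ℝ) (G : GEq.Pt d × ℝ → ℝ),
      GEq.IsFrontLike G₀ → GEq.SolvesGEquation ε α u G₀ G →
      (∀ t, 0 < t → GEq.front t G = GEq.front t (GEq.ptw ε χ)) ∧
      GEq.subLevel G = GEq.subLevel (GEq.ptw ε χ)) := by
  have hH := GEq.isGeometric_gHamiltonian (α := α) hε hu hbound
  refine ⟨fun ρ χ hρ hsol => ?_, fun χ hχ G₀ G hG₀ hG => ⟨fun t ht => ?_, ?_⟩⟩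
  · obtain rfl : (fun z => GEq.ptw ε χ (z, 0)) = ρ := funext hsol.initial
    exact ⟨hsol, hρ.isFrontLike hε fun z => hbound z 0 le_rfl⟩
  · exact GEq.front_eq_of_isFrontLike hH hG hχ.solves hG₀ hχ.frontLike ht.le
  · exact GEq.subLevel_eq_of_isFrontLike hH hG hχ.solves hG₀ hχ.frontLike

theorem proposition2p2 {Ω : Type*} [MeasurableSpace Ω] (P : MeasureTheory.Measure Ω)
    [MeasureTheory.IsProbabilityMeasure P]
    (n : ℕ) (hn : 2 ≤ n)
    (w : ℝ → Ω → ℝ) (hw : GEq.IsMildWhiteNoise P w)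
    (uperp : GEq.Tr (n - 1) × ℝ × ℝ → GEq.Tr (n - 1))
    (huperp : ContDiffOn ℝ 2 uperp {q | 0 ≤ q.2.2})
    (upar : GEq.Tr (n - 1) × ℝ → ℝ)
    (hupar : ContDiffOn ℝ 2 upar {q | 0 ≤ q.2}) :
    ∀ᵐ ω ∂P, ∀ u : GEq.Pt (n - 1) → ℝ → GEq.Pt (n - 1),
      u = GEq.advection uperp upar (fun y => w y ω) →
      ∀ (ε : ℝ) (α : ENNReal), 0 < ε → 1 ≤ α →
      (∀ z t, 0 ≤ t → ε * ‖u z t‖ ≤ 1 / 100) →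
      -- the solution that starts from the planar metric profile is a perturbed traveling wave
      (∀ (ρ : GEq.Pt (n - 1) → ℝ) (χ : GEq.Tr (n - 1) × ℝ × ℝ → ℝ),
        GEq.IsPlanarMetricSolution ε (fun z => u z 0) ρ →
        GEq.SolvesGEquation ε α u ρ (GEq.ptw ε χ) →
        GEq.IsPerturbedTravelingWave ε α u χ) ∧
      -- the front of any solution with front-like datum is that of the perturbed traveling wave
      (∀ (χ : GEq.Tr (n - 1) × ℝ × ℝ → ℝ), GEq.IsPerturbedTravelingWave ε α u χ →
        ∀ (G₀ : GEq.Pt (n - 1) → ℝ) (G : GEq.Pt (n - 1) × ℝ → ℝ),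
        GEq.IsFrontLike G₀ → GEq.SolvesGEquation ε α u G₀ G →
        (∀ t, 0 < t → GEq.front t G = GEq.front t (GEq.ptw ε χ)) ∧
        GEq.subLevel G = GEq.subLevel (GEq.ptw ε χ)) := by
  obtain ⟨M, -, hM⟩ := hw.c1_bound
  filter_upwards [hM] with ω hω u hu ε α hε _ hbound
  have hLip := GEq.locallyLipschitzOn_advection (huperp.of_le one_le_two) (hupar.of_le one_le_two)
    hω.1
  exact proposition2p2_general (hu ▸ hLip) hε.le hbound
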